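/- **Setting.** Let $\rho>0$, $a\in C[0,1]$ be real-valued, $q_0,q_1\in\mathbb{R}$, and let $X=L_2(0,1)$ (real or complex) with inner product $\langle x,y\rangle=\int_0^1x(\zeta)\overline{y(\zeta)}\,d\zeta$ and norm $\|\cdot\|$. Consider the boundary-controlled parabolic system $$\dot x(z,t)=\rho\,x''(z,t)+a(z)\,x(z,t)\ \ (0<z<1),\qquad x'(0,t)=q_0x(0,t)+u_1(t),\quad x'(1,t)=q_1x(1,t)+u_2(t),\qquad t>0,$$ where a dot is $\partial_t$ and a prime is $\partial_z$. Let $\mathcal{A}h=\rho h''+ah$ with domain $D(\mathcal{A})=\{h\in H^2(0,1): h'(0)=q_0h(0),\ h'(1)=q_1h(1)\}$, let $\lambda_1>\lambda_2>\cdots$ be all eigenvalues of $\mathcal{A}$, and let $\phi_i$ be corresponding real-valued eigenfunctions with $\|\phi_i\|=1$. Put $\varphi_i[x]=\langle x,\phi_i\rangle$ and $\underline{\varphi}_n[x]=(\varphi_1[x],\dots,\varphi_n[x])^\top$. Let $\Lambda_n=\operatorname{diag}(\lambda_1,\dots,\lambda_n)$, let $B_n\in\mathbb{R}^{n\times2}$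 be the matrix with rows $b_i^\top=\rho\,(-\phi_i(0),\ \phi_i(1))$, $i=1,\dots,n$, where $n\ge1$, and let $K\in\mathbb{R}^{2\times n}$. The closed loop is the system above with $u(t)=(u_1(t),u_2(t))^\top=-K\underline{\varphi}_n[x(t)]$. A solution of it is a function $x\in C([0,\infty),X)$ that, for every $t>0$, is differentiable at $t$ as an $X$-valued function, has $x(t)\in H^2(0,1)$, and satisfies the differential equation in $X$ and both boundary conditions. **Theorem (stabilizing state feedback controller).** Assume that $\lambda_{\max}=\max_{\lambda\in\sigma(\Lambda_n-B_nK)}\operatorname{Re}\lambda<0$, and let $\epsilon>0$ be such that $\alpha=\lambda_{\max}+\epsilon$ satisfies $\lambda_i<\alpha<0$ for all $i>n$. Then the closed loop is exponentially stable in the $L_2$-norm: there is a constant $M_x\ge1$ such that for every $x_0\in X$ the closed loop has a solution with $x(0)=x_0$, and every solution satisfies $$\|x(t)\|\le M_x\,e^{\alpha t}\,\|x(0)\|,\qquad t\ge0.$$ -/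

import Mathlib

open MeasureTheory

noncomputable section

/-- The state space `L²(0,1)`, real (`𝕜 = ℝ`) or complex (`𝕜 = ℂ`). -/
abbrev StateSpace (𝕜 : Type*) [RCLike 𝕜] : Type _ :=
  Lp 𝕜 2 (volume.restrict (Set.Ioo (0 : ℝ) 1))

/-- `h` (restricted to `[0,1]`) is the `C¹` representative of an element of the Sobolev space
`H²(0,1)`: `h` is continuously differentiable on `[0,1]` with derivative `h₁`, and `h₁` is absolutely
continuous with derivative `h₂ ∈ L²(0,1)`. -/
structure IsH2 {𝕜 : Type*} [RCLike 𝕜] (h h₁ h₂ : ℝ → 𝕜) : Prop where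
  hasDeriv : ∀ z ∈ Set.Icc (0 : ℝ) 1, HasDerivWithinAt h (h₁ z) (Set.Icc 0 1) z
  memLp : MemLp h₂ 2 (volume.restrict (Set.Ioo (0 : ℝ) 1))
  absCont : ∀ z ∈ Set.Icc (0 : ℝ) 1, h₁ z = h₁ 0 + ∫ ζ in (0 : ℝ)..z, h₂ ζ

/-- The spatial part of the plant, at one instant: `h ∈ H²(0,1)`, `ρ h'' + a h = f` a.e. on `(0,1)`,
and the Robin boundary conditions `h'(0) = q₀ h(0) + u₁`, `h'(1) = q₁ h(1) + u₂` hold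
(`u₁ = u 0`, `u₂ = u 1`). For `u = 0` this says `h ∈ D(𝒜)` and `𝒜 h = f`. -/
def RobinRel {𝕜 : Type*} [RCLike 𝕜] (ρ : ℝ) (a : ℝ → ℝ) (q₀ q₁ : ℝ) (u : Fin 2 → 𝕜)
    (h f : ℝ → 𝕜) : Prop :=
  ∃ h₁ h₂ : ℝ → 𝕜, IsH2 h h₁ h₂ ∧
    (∀ᵐ z ∂(volume.restrict (Set.Ioo (0 : ℝ) 1)), f z = (ρ : 𝕜) * h₂ z + (a z : 𝕜) * h z) ∧
    h₁ 0 = (q₀ : 𝕜) * h 0 + u 0 ∧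
    h₁ 1 = (q₁ : 𝕜) * h 1 + u 1

/-- `μ` is an eigenvalue of the open-loop operator `𝒜` (`u = 0`) and `φ` is an eigenfunction for it
with `‖φ‖ = 1` in `L²(0,1)`. -/
def IsUnitEigenfunction (ρ : ℝ) (a : ℝ → ℝ) (q₀ q₁ : ℝ) (μ : ℝ) (φ : ℝ → ℝ) : Prop :=
  RobinRel ρ a q₀ q₁ (0 : Fin 2 → ℝ) φ (fun z => μ * φ z) ∧
    ∫ z in Set.Ioo (0 : ℝ) 1, φ z ^ 2 = 1

/-- `lam 0 > lam 1 > ⋯` is the list of all eigenvalues of `𝒜`, and `φ i` is a normalized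
eigenfunction for `lam i`. -/
structure IsEigenSequence (ρ : ℝ) (a : ℝ → ℝ) (q₀ q₁ : ℝ) (lam : ℕ → ℝ) (φ : ℕ → ℝ → ℝ) :
    Prop where
  strictAnti : StrictAnti lam
  eigen : ∀ i, IsUnitEigenfunction ρ a q₀ q₁ (lam i) (φ i)
  exhaust : ∀ (μ : ℝ) (ψ : ℝ → ℝ), IsUnitEigenfunction ρ a q₀ q₁ μ ψ → ∃ i, lam i = μ

/-- The (Koopman) eigenfunctional `φ[x] = ⟨x, φ⟩ = ∫₀¹ x(ζ) φ(ζ) dζ` of a real-valued `φ`. -/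
def eigenfunctional {𝕜 : Type*} [RCLike 𝕜] (φ : ℝ → ℝ) (x : StateSpace 𝕜) : 𝕜 :=
  ∫ z in Set.Ioo (0 : ℝ) 1, x z * (φ z : 𝕜)

/-- The state feedback `uᵢ = - ∑_{j<n} kⁱⱼ φⱼ[x]`, i.e. `u = - K φₙ[x]`. -/
def feedback {𝕜 : Type*} [RCLike 𝕜] {n : ℕ} (K : Matrix (Fin 2) (Fin n) ℝ) (φ : ℕ → ℝ → ℝ)
    (x : StateSpace 𝕜) : Fin 2 → 𝕜 :=
  fun i => -∑ j : Fin n, (K i j : 𝕜) * eigenfunctional (φ j) x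

/-- `Λₙ = diag(lam 0, …, lam (n-1))`. -/
def modalMatrix (n : ℕ) (lam : ℕ → ℝ) : Matrix (Fin n) (Fin n) ℝ :=
  Matrix.diagonal fun i => lam i

/-- `Bₙ`, whose `i`-th row is `bᵢᵀ = ρ (-φᵢ(0), φᵢ(1))`. -/
def inputMatrix (n : ℕ) (ρ : ℝ) (φ : ℕ → ℝ → ℝ) : Matrix (Fin n) (Fin 2) ℝ :=
  Matrix.of fun i => ![-(ρ * φ i 0), ρ * φ i 1]

/-- `x` is a trajectory on `[0, ∞)` of the closed loop, i.e. of the plant with `u(t) = - K φₙ[x(t)]`: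
it is continuous in `L²(0,1)` for `t ≥ 0`, and for every `t > 0` it is differentiable in `L²(0,1)`,
`x(t)` has an `H²` representative `h`, and the plant equations hold. -/
structure IsClosedLoopSolution {𝕜 : Type*} [RCLike 𝕜] (ρ : ℝ) (a : ℝ → ℝ) (q₀ q₁ : ℝ) {n : ℕ}
    (K : Matrix (Fin 2) (Fin n) ℝ) (φ : ℕ → ℝ → ℝ) (x : ℝ → StateSpace 𝕜) : Prop where
  continuousOn : ContinuousOn x (Set.Ici 0)
  dynamics : ∀ t : ℝ, 0 < t → ∃ (h : ℝ → 𝕜) (y : StateSpace 𝕜), HasDerivAt x y t ∧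
    (x t =ᵐ[volume.restrict (Set.Ioo (0 : ℝ) 1)] h) ∧
    RobinRel ρ a q₀ q₁ (feedback K φ (x t)) h y

end

/-! The proof diagonalizes the plant. The normalized eigenfunctions form a Hilbert basis of L²(0,1)
(`IsEigenSequence.exists_hilbertBasis`): off the spectrum the Robin operator has a compact symmetric
resolvent (`exists_resolvent`), and its eigenvalues are simple. Green's formula turns a closed-loop
trajectory into the scalar equations c_i' = λ_i c_i - ∑_{j<n} κ_ij c_j for its modes, with κ_ij = ρ
(K_1j φ_i(1) - K_0j φ_i(0)).

The first n equations form the closed system with matrix Λ_n - B_n K. Since α lies strictly above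
its spectral abscissa, these modes decay like e^{αt} without polynomial factors
(`exists_bound_of_linear_system`). Every later mode is a stable scalar equation driven by them, and
Duhamel's formula bounds it by e^{αt} (|c_i(0)| + const · ∑_j |κ_ij| / (α - λ_i)). The point of the
proof is that these spillover weights are square summable (`IsEigenSequence.summable_sq_input`).
This needs no eigenvalue asymptotics: an H² lift of the boundary data expresses β_i / (α - λ_i),
with β_i the boundary coefficient of mode i, through Fourier coefficients of L² functions.
Parseval's identity then gives the exponential bound.

For existence, the modal equations are solved explicitly and the solutions summed. At positive times
the factor e^{-(α-λ_i)t} absorbs the growth of λ_i (`norm_modal_deriv_le`), so the sum is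
differentiable in L². By `IsEigenSequence.exists_robinRel_of_modal` the modal equations imply H²
regularity, the differential equation and the boundary conditions. -/

noncomputable section

/-! ### Integrals and primitives on the unit interval. -/

theorem restrict_Ioo_zero_one_restrict_Ioc {z : ℝ} (hz : z ∈ Set.Icc (0 : ℝ) 1) :
    (volume.restrict (Set.Ioo (0 : ℝ) 1)).restrict (Set.Ioc 0 z) =
      volume.restrict (Set.Ioc 0 z) := by
  rw [restrict_Ioo_eq_restrict_Ioc, Measure.restrict_restrict measurableSet_Ioc,
    Set.inter_eq_left.2 (Set.Ioc_subset_Ioc_right hz.2)]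

theorem intervalIntegral_eq_setIntegral_Ioo {E : Type*} [NormedAddCommGroup E] [NormedSpace ℝ E]
    (g : ℝ → E) {z : ℝ} (hz : z ∈ Set.Icc (0 : ℝ) 1) :
    ∫ ζ in (0 : ℝ)..z, g ζ = ∫ ζ in Set.Ioc 0 z, g ζ ∂(volume.restrict (Set.Ioo (0 : ℝ) 1)) := by
  rw [restrict_Ioo_zero_one_restrict_Ioc hz, intervalIntegral.integral_of_le hz.1]

theorem intervalIntegral_zero_one_eq {E : Type*} [NormedAddCommGroup E] [NormedSpace ℝ E]
    (g : ℝ → E) : ∫ ζ in (0 : ℝ)..1, g ζ = ∫ ζ in Set.Ioo (0 : ℝ) 1, g ζ := by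
  rw [intervalIntegral.integral_of_le zero_le_one, restrict_Ioo_eq_restrict_Ioc]

theorem MeasureTheory.IntegrableOn.intervalIntegrable_of_Ioo_zero_one
    {E : Type*} [NormedAddCommGroup E]
    {g : ℝ → E} (hg : IntegrableOn g (Set.Ioo (0 : ℝ) 1)) {x y : ℝ} (hx : x ∈ Set.Icc (0 : ℝ) 1)
    (hy : y ∈ Set.Icc (0 : ℝ) 1) : IntervalIntegrable g volume x y := by
  have h : IntervalIntegrable g volume 0 1 := by
    rw [intervalIntegrable_iff_integrableOn_Ioo_of_le zero_le_one]; exact hg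
  refine h.mono_set ?_
  rw [Set.uIcc_of_le (zero_le_one' ℝ)]
  exact Set.uIcc_subset_Icc hx hy

theorem ContinuousOn.memLp_Ioo_zero_one {E : Type*} [NormedAddCommGroup E]
    {g : ℝ → E} (hg : ContinuousOn g (Set.Icc 0 1)) (p : ENNReal) :
    MemLp g p (volume.restrict (Set.Ioo (0 : ℝ) 1)) := by
  obtain ⟨C, hC⟩ := isCompact_Icc.exists_bound_of_continuousOn hg
  refine MemLp.of_bound ?_ C ?_
  · exact (hg.aestronglyMeasurable measurableSet_Icc).mono_measure
      (Measure.restrict_mono Set.Ioo_subset_Icc_self le_rfl)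
  · filter_upwards [self_mem_ae_restrict measurableSet_Ioo] with z hz
    exact hC z (Set.Ioo_subset_Icc_self hz)

theorem MeasureTheory.IntegrableOn.continuousOn_primitive_zero_one
    {E : Type*} [NormedAddCommGroup E] [NormedSpace ℝ E]
    {g : ℝ → E} (hg : IntegrableOn g (Set.Ioo (0 : ℝ) 1)) :
    ContinuousOn (fun z => ∫ ζ in (0 : ℝ)..z, g ζ) (Set.Icc 0 1) := by
  have h : IntegrableOn g (Set.uIcc (0 : ℝ) 1) := by
    rw [Set.uIcc_of_le (zero_le_one' ℝ), integrableOn_Icc_iff_integrableOn_Ioo]; exact hg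
  simpa [Set.uIcc_of_le (zero_le_one' ℝ)] using
    intervalIntegral.continuousOn_primitive_interval h

theorem intervalIntegral_hasDerivWithinAt_of_continuousOn {E : Type*} [NormedAddCommGroup E]
    [NormedSpace ℝ E] [CompleteSpace E] {g : ℝ → E} (hg : ContinuousOn g (Set.Icc 0 1))
    {z : ℝ} (hz : z ∈ Set.Icc (0 : ℝ) 1) :
    HasDerivWithinAt (fun w => ∫ ζ in (0 : ℝ)..w, g ζ) (g z) (Set.Icc 0 1) z := by
  -- Constant extension beyond the endpoints gives a function continuous on ℝ, so the two-sided
  -- fundamental theorem also covers z = 0 and z = 1.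
  let G : ℝ → E := Set.IccExtend (zero_le_one' ℝ) (Set.domRestrict (Set.Icc 0 1) g)
  have hG : Continuous G := hg.domRestrict.Icc_extend'
  have hGg : ∀ w ∈ Set.Icc (0 : ℝ) 1, G w = g w := fun w hw => by
    simp only [G, Set.IccExtend_of_mem _ _ hw, Set.domRestrict_apply]
  have h := (intervalIntegral.integral_hasDerivAt_right (hG.intervalIntegrable 0 z)
    (hG.stronglyMeasurableAtFilter _ _) hG.continuousAt).hasDerivWithinAt (s := Set.Icc 0 1)
  rw [← hGg z hz]
  have hcongr : ∀ w ∈ Set.Icc (0 : ℝ) 1, ∫ ζ in (0 : ℝ)..w, g ζ = ∫ ζ in (0 : ℝ)..w, G ζ := by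
    intro w hw
    refine intervalIntegral.integral_congr fun ζ hζ => (hGg ζ ?_).symm
    rw [Set.uIcc_of_le hw.1] at hζ
    exact ⟨hζ.1, hζ.2.trans hw.2⟩
  exact h.congr hcongr (hcongr z hz)

/-! ### Integration by parts, Green's formula and boundary lifts. -/

section Parts

variable {𝕜 : Type*} [RCLike 𝕜]

/-- Exchange of the order of integration over the triangle `0 < ζ < z < 1`. -/
theorem setIntegral_primitive_mul {g k : ℝ → 𝕜} (hg : IntegrableOn g (Set.Ioo (0 : ℝ) 1))
    (hk : IntegrableOn k (Set.Ioo (0 : ℝ) 1)) :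
    ∫ z in Set.Ioo (0 : ℝ) 1, (∫ ζ in (0 : ℝ)..z, g ζ) * k z =
      ∫ ζ in Set.Ioo (0 : ℝ) 1, g ζ * ∫ z in ζ..1, k z := by
  set F : ℝ → ℝ → 𝕜 := fun z ζ => {p : ℝ × ℝ | p.2 ≤ p.1}.indicator
    (fun p => k p.1 * g p.2) (z, ζ) with hF
  have hmeas : MeasurableSet {p : ℝ × ℝ | p.2 ≤ p.1} :=
    measurableSet_le measurable_snd measurable_fst
  have hint : Integrable (Function.uncurry F) ((volume.restrict (Set.Ioo (0 : ℝ) 1)).prod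
      (volume.restrict (Set.Ioo (0 : ℝ) 1))) := by
    have : Function.uncurry F = {p : ℝ × ℝ | p.2 ≤ p.1}.indicator (fun p => k p.1 * g p.2) := by
      ext ⟨z, ζ⟩; rfl
    rw [this]
    exact (Integrable.mul_prod hk hg).indicator hmeas
  have hswap := integral_integral_swap hint
  refine Eq.trans ?_ (hswap.trans ?_)
  · refine setIntegral_congr_fun measurableSet_Ioo fun z hz => ?_
    have hz' := Set.Ioo_subset_Icc_self hz
    show (∫ ζ in (0 : ℝ)..z, g ζ) * k z = ∫ ζ in Set.Ioo (0 : ℝ) 1, F z ζ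
    have hFz : Set.EqOn (F z) ((Set.Ioc 0 z).indicator fun ζ => k z * g ζ) (Set.Ioo 0 1) := by
      intro ζ hζ
      simp only [hF, Set.indicator_apply, Set.mem_ofPred_eq, Set.mem_Ioc, hζ.1, true_and]
    rw [setIntegral_congr_fun measurableSet_Ioo hFz, integral_indicator measurableSet_Ioc,
      restrict_Ioo_zero_one_restrict_Ioc hz', integral_const_mul,
      intervalIntegral.integral_of_le hz'.1, mul_comm]
  · refine setIntegral_congr_fun measurableSet_Ioo fun ζ hζ => ?_
    show ∫ z in Set.Ioo (0 : ℝ) 1, F z ζ = g ζ * ∫ z in ζ..1, k z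
    have hFz : Set.EqOn (fun z => F z ζ) ((Set.Ico ζ 1).indicator fun z => k z * g ζ)
        (Set.Ioo 0 1) := by
      intro z hz
      simp only [hF, Set.indicator_apply, Set.mem_ofPred_eq, Set.mem_Ico, hz.2, and_true]
    rw [setIntegral_congr_fun measurableSet_Ioo hFz, integral_indicator measurableSet_Ico,
      Measure.restrict_restrict measurableSet_Ico, integral_mul_const,
      intervalIntegral.integral_of_le hζ.2.le, mul_comm]
    have : Set.Ico ζ 1 ∩ Set.Ioo 0 1 = Set.Ico ζ 1 := by
      refine Set.inter_eq_left.2 fun z hz => ⟨hζ.1.trans_le hz.1, hz.2⟩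
    rw [this, restrict_Ico_eq_restrict_Ioc]

end Parts

namespace IsH2

variable {𝕜 : Type*} [RCLike 𝕜] {h h₁ h₂ k k₁ k₂ : ℝ → 𝕜}

theorem continuousOn (H : IsH2 h h₁ h₂) : ContinuousOn h (Set.Icc 0 1) :=
  fun z hz => (H.hasDeriv z hz).continuousWithinAt

theorem integrableOn (H : IsH2 h h₁ h₂) : IntegrableOn h₂ (Set.Ioo (0 : ℝ) 1) :=
  H.memLp.integrable one_le_two

theorem continuousOn_deriv (H : IsH2 h h₁ h₂) : ContinuousOn h₁ (Set.Icc 0 1) :=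
  (continuousOn_const.add H.integrableOn.continuousOn_primitive_zero_one).congr H.absCont

theorem integral_deriv (H : IsH2 h h₁ h₂) {x y : ℝ} (hx : x ∈ Set.Icc (0 : ℝ) 1)
    (hy : y ∈ Set.Icc (0 : ℝ) 1) (hxy : x ≤ y) : ∫ z in x..y, h₁ z = h y - h x := by
  have hsub : Set.Icc x y ⊆ Set.Icc 0 1 := Set.Icc_subset_Icc hx.1 hy.2
  refine intervalIntegral.integral_eq_sub_of_hasDerivAt_of_le hxy (H.continuousOn.mono hsub) ?_ ?_
  · intro z hz
    exact (H.hasDeriv z (hsub (Set.Ioo_subset_Icc_self hz))).hasDerivAt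
      (Icc_mem_nhds (hx.1.trans_lt hz.1) (hz.2.trans_le hy.2))
  · exact (H.continuousOn_deriv.mono (by rwa [Set.uIcc_of_le hxy])).intervalIntegrable

/-- Integration by parts for `H²` functions. -/
theorem integral_second_deriv_mul (H : IsH2 h h₁ h₂) (K : IsH2 k k₁ k₂) :
    ∫ z in Set.Ioo (0 : ℝ) 1, h₂ z * k z =
      h₁ 1 * k 1 - h₁ 0 * k 0 - ∫ z in Set.Ioo (0 : ℝ) 1, h₁ z * k₁ z := by
  have h0 : (0 : ℝ) ∈ Set.Icc (0 : ℝ) 1 := by simp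
  have h1 : (1 : ℝ) ∈ Set.Icc (0 : ℝ) 1 := by simp
  have hk₁ : IntegrableOn k₁ (Set.Ioo (0 : ℝ) 1) :=
    (K.continuousOn_deriv.memLp_Ioo_zero_one 1).integrable le_rfl
  have hP : ContinuousOn (fun z => ∫ ζ in (0 : ℝ)..z, h₂ ζ) (Set.Icc 0 1) :=
    H.integrableOn.continuousOn_primitive_zero_one
  have hhk : IntegrableOn (fun z => h₂ z * k z) (Set.Ioo (0 : ℝ) 1) :=
    H.memLp.integrable_mul (K.continuousOn.memLp_Ioo_zero_one 2)
  -- `h₁` is only absolutely continuous, so the product rule is replaced by writing `h₁` as a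
  -- primitive of `h₂` and applying Fubini.
  have key := setIntegral_primitive_mul H.integrableOn hk₁
  have e1 : ∫ z in Set.Ioo (0 : ℝ) 1, h₁ z * k₁ z =
      h₁ 0 * (k 1 - k 0) + ∫ z in Set.Ioo (0 : ℝ) 1, (∫ ζ in (0 : ℝ)..z, h₂ ζ) * k₁ z := by
    rw [← K.integral_deriv h0 h1 zero_le_one, intervalIntegral_zero_one_eq, ← integral_const_mul,
      ← integral_add]
    · refine setIntegral_congr_fun measurableSet_Ioo fun z hz => ?_
      simp only [H.absCont z (Set.Ioo_subset_Icc_self hz), add_mul]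
    · exact hk₁.const_mul _
    · exact ((hP.mul K.continuousOn_deriv).memLp_Ioo_zero_one 1).integrable le_rfl
  have e2 : ∫ ζ in Set.Ioo (0 : ℝ) 1, h₂ ζ * ∫ z in ζ..1, k₁ z =
      (h₁ 1 - h₁ 0) * k 1 - ∫ z in Set.Ioo (0 : ℝ) 1, h₂ z * k z := by
    have : h₁ 1 - h₁ 0 = ∫ ζ in Set.Ioo (0 : ℝ) 1, h₂ ζ := by
      rw [H.absCont 1 h1, intervalIntegral_zero_one_eq]; ring
    rw [this, ← integral_mul_const, ← integral_sub (H.integrableOn.mul_const _) hhk]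
    refine setIntegral_congr_fun measurableSet_Ioo fun z hz => ?_
    simp only [K.integral_deriv (Set.Ioo_subset_Icc_self hz) h1 hz.2.le]
    ring
  rw [e1, key, e2]; ring

theorem add (H : IsH2 h h₁ h₂) (K : IsH2 k k₁ k₂) :
    IsH2 (fun z => h z + k z) (fun z => h₁ z + k₁ z) (fun z => h₂ z + k₂ z) where
  hasDeriv z hz := (H.hasDeriv z hz).add (K.hasDeriv z hz)
  memLp := H.memLp.add K.memLp
  absCont z hz := by
    rw [H.absCont z hz, K.absCont z hz, intervalIntegral.integral_add]
    · ring
    · exact H.integrableOn.intervalIntegrable_of_Ioo_zero_one (by simp) hz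
    · exact K.integrableOn.intervalIntegrable_of_Ioo_zero_one (by simp) hz

theorem const_mul (H : IsH2 h h₁ h₂) (c : 𝕜) :
    IsH2 (fun z => c * h z) (fun z => c * h₁ z) (fun z => c * h₂ z) where
  hasDeriv z hz := (H.hasDeriv z hz).const_mul c
  memLp := H.memLp.const_mul c
  absCont z hz := by
    rw [H.absCont z hz, intervalIntegral.integral_const_mul]; ring

theorem ofReal {h h₁ h₂ : ℝ → ℝ} (H : IsH2 h h₁ h₂) :
    IsH2 (fun z => (h z : 𝕜)) (fun z => (h₁ z : 𝕜)) (fun z => (h₂ z : 𝕜)) where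
  hasDeriv z hz := by
    have := (RCLike.ofRealCLM (K := 𝕜)).hasFDerivAt.comp_hasDerivWithinAt z (H.hasDeriv z hz)
    simpa [Function.comp_def] using this
  memLp := H.memLp.ofReal
  absCont z hz := by
    have h := (RCLike.ofRealCLM (K := 𝕜)).intervalIntegral_comp_comm
      (H.integrableOn.intervalIntegrable_of_Ioo_zero_one (Set.left_mem_Icc.2 zero_le_one) hz)
    simp only [RCLike.ofRealCLM_apply] at h
    rw [h, H.absCont z hz, RCLike.ofReal_add]

end IsH2

namespace RobinRel

variable {𝕜 : Type*} [RCLike 𝕜] {ρ : ℝ} {a : ℝ → ℝ} {q₀ q₁ : ℝ} {u w : Fin 2 → 𝕜}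
  {h k f g : ℝ → 𝕜}

theorem continuousOn (H : RobinRel ρ a q₀ q₁ u h f) : ContinuousOn h (Set.Icc 0 1) := by
  obtain ⟨_, _, H, _⟩ := H
  exact H.continuousOn

theorem memLp (H : RobinRel ρ a q₀ q₁ u h f) :
    MemLp h 2 (volume.restrict (Set.Ioo (0 : ℝ) 1)) :=
  H.continuousOn.memLp_Ioo_zero_one 2

theorem memLp_right (ha : ContinuousOn a (Set.Icc 0 1)) (H : RobinRel ρ a q₀ q₁ u h f) :
    MemLp f 2 (volume.restrict (Set.Ioo (0 : ℝ) 1)) := by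
  obtain ⟨h₁, h₂, H, hf, _⟩ := H
  refine MemLp.ae_eq (Filter.EventuallyEq.symm hf) ?_
  refine (H.memLp.const_mul _).add (ContinuousOn.memLp_Ioo_zero_one ?_ 2)
  exact (RCLike.continuous_ofReal.comp_continuousOn ha).mul H.continuousOn

theorem congr_right (H : RobinRel ρ a q₀ q₁ u h f)
    (hfg : f =ᵐ[volume.restrict (Set.Ioo (0 : ℝ) 1)] g) : RobinRel ρ a q₀ q₁ u h g := by
  obtain ⟨h₁, h₂, H, hf, hb⟩ := H
  refine ⟨h₁, h₂, H, ?_, hb⟩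
  filter_upwards [hf, hfg] with z h1 h2
  rw [← h2, h1]

theorem add (H : RobinRel ρ a q₀ q₁ u h f) (K : RobinRel ρ a q₀ q₁ w k g) :
    RobinRel ρ a q₀ q₁ (u + w) (fun z => h z + k z) (fun z => f z + g z) := by
  obtain ⟨h₁, h₂, H, hf, hb₀, hb₁⟩ := H
  obtain ⟨k₁, k₂, K, kf, kb₀, kb₁⟩ := K
  refine ⟨_, _, H.add K, ?_, ?_, ?_⟩
  · filter_upwards [hf, kf] with z h1 h2
    rw [h1, h2]; ring
  · simp only [hb₀, kb₀, Pi.add_apply]; ring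
  · simp only [hb₁, kb₁, Pi.add_apply]; ring

theorem const_mul (H : RobinRel ρ a q₀ q₁ u h f) (c : 𝕜) :
    RobinRel ρ a q₀ q₁ (c • u) (fun z => c * h z) (fun z => c * f z) := by
  obtain ⟨h₁, h₂, H, hf, hb₀, hb₁⟩ := H
  refine ⟨_, _, H.const_mul c, ?_, ?_, ?_⟩
  · filter_upwards [hf] with z h1
    rw [h1]; ring
  · simp only [hb₀, Pi.smul_apply, smul_eq_mul]; ring
  · simp only [hb₁, Pi.smul_apply, smul_eq_mul]; ring

theorem ofReal {u : Fin 2 → ℝ} {h f : ℝ → ℝ} (H : RobinRel ρ a q₀ q₁ u h f) :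
    RobinRel ρ a q₀ q₁ (fun i => (u i : 𝕜)) (fun z => (h z : 𝕜)) (fun z => (f z : 𝕜)) := by
  obtain ⟨h₁, h₂, H, hf, hb₀, hb₁⟩ := H
  refine ⟨_, _, H.ofReal, ?_, ?_, ?_⟩
  · filter_upwards [hf] with z h1
    rw [h1]; simp
  · simp [hb₀]
  · simp [hb₁]

/-- Green's formula for the Robin problem with inhomogeneous boundary data. -/
theorem green (ha : ContinuousOn a (Set.Icc 0 1)) (H : RobinRel ρ a q₀ q₁ u h f)
    (K : RobinRel ρ a q₀ q₁ w k g) :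
    ∫ z in Set.Ioo (0 : ℝ) 1, f z * k z =
      (∫ z in Set.Ioo (0 : ℝ) 1, h z * g z) +
        ρ * (u 1 * k 1 - u 0 * k 0 - w 1 * h 1 + w 0 * h 0) := by
  have hfk : IntegrableOn (fun z => f z * k z) (Set.Ioo (0 : ℝ) 1) :=
    (H.memLp_right ha).integrable_mul K.memLp
  have hhg : IntegrableOn (fun z => h z * g z) (Set.Ioo (0 : ℝ) 1) :=
    H.memLp.integrable_mul (K.memLp_right ha)
  obtain ⟨h₁, h₂, H, hf, hb₀, hb₁⟩ := H
  obtain ⟨k₁, k₂, K, kf, kb₀, kb₁⟩ := K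
  have e1 := H.integral_second_deriv_mul K
  have e2 := K.integral_second_deriv_mul H
  have i1 : IntegrableOn (fun z => h₂ z * k z) (Set.Ioo (0 : ℝ) 1) :=
    H.memLp.integrable_mul (K.continuousOn.memLp_Ioo_zero_one 2)
  have i2 : IntegrableOn (fun z => k₂ z * h z) (Set.Ioo (0 : ℝ) 1) :=
    K.memLp.integrable_mul (H.continuousOn.memLp_Ioo_zero_one 2)
  -- The terms containing `a` cancel in the difference.
  have e3 : (∫ z in Set.Ioo (0 : ℝ) 1, f z * k z) - (∫ z in Set.Ioo (0 : ℝ) 1, h z * g z) =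
      ρ * ((∫ z in Set.Ioo (0 : ℝ) 1, h₂ z * k z) - ∫ z in Set.Ioo (0 : ℝ) 1, k₂ z * h z) := by
    rw [← integral_sub hfk hhg, ← integral_sub i1 i2, ← integral_const_mul]
    refine integral_congr_ae ?_
    filter_upwards [hf, kf] with z h1 h2
    rw [h1, h2]; ring
  have e4 : ∫ z in Set.Ioo (0 : ℝ) 1, k₁ z * h₁ z = ∫ z in Set.Ioo (0 : ℝ) 1, h₁ z * k₁ z := by
    simp_rw [mul_comm]
  rw [e1, e2, e4, hb₀, hb₁, kb₀, kb₁] at e3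
  linear_combination e3

end RobinRel

/-- A function of class `C²` belongs to `H²(0,1)`. -/
theorem isH2_of_hasDerivAt {h h₁ h₂ : ℝ → ℝ} (hh : ∀ z, HasDerivAt h (h₁ z) z)
    (hh₁ : ∀ z, HasDerivAt h₁ (h₂ z) z) (hc : Continuous h₂) : IsH2 h h₁ h₂ where
  hasDeriv z _ := (hh z).hasDerivWithinAt
  memLp := hc.continuousOn.memLp_Ioo_zero_one 2
  absCont z _ := by
    rw [intervalIntegral.integral_eq_sub_of_hasDerivAt (fun x _ => hh₁ x)
      (hc.intervalIntegrable _ _)]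
    ring

/-- Every boundary datum has an `H²` lift. -/
theorem exists_robin_lift (ρ : ℝ) (a : ℝ → ℝ) (q₀ q₁ : ℝ) (u : Fin 2 → ℝ) :
    ∃ h f : ℝ → ℝ, RobinRel ρ a q₀ q₁ u h f := by
  -- Both cubics vanish at 0 and 1. The first has slopes 1 and 0 there, the second 0 and 1, so the
  -- Robin terms drop out.
  refine ⟨fun z => u 0 * (z * (1 - z) ^ 2) + u 1 * (z ^ 2 * (z - 1)), _,
    fun z => u 0 * (1 - 4 * z + 3 * z ^ 2) + u 1 * (3 * z ^ 2 - 2 * z),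
    fun z => u 0 * (-4 + 6 * z) + u 1 * (6 * z - 2),
    isH2_of_hasDerivAt ?_ ?_ (by fun_prop), Filter.Eventually.of_forall fun z => rfl, ?_, ?_⟩
  · intro z
    have hz := hasDerivAt_id' z
    convert! ((hz.mul ((hz.const_sub 1).pow 2)).const_mul (u 0)).add
      (((hz.pow 2).mul (hz.sub_const 1)).const_mul (u 1)) using 1
    simp; ring
  · intro z
    have hz := hasDerivAt_id' z
    convert! ((((hz.const_mul 4).const_sub 1).add ((hz.pow 2).const_mul 3)).const_mul (u 0)).add
      ((((hz.pow 2).const_mul 3).sub (hz.const_mul 2)).const_mul (u 1)) using 1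
    simp; ring
  · simp
  · norm_num

/-! ### Compactness of the Volterra operator. -/

/-- A family of functionals `⟪k x, ·⟫` depending continuously on a point of a compact space defines
a compact operator into the space of continuous functions. -/
theorem isCompactOperator_of_apply_eq_inner {X : Type*} [TopologicalSpace X] [CompactSpace X]
    {H : Type*} [NormedAddCommGroup H] [InnerProductSpace ℝ H] (k : C(X, H))
    (L : H → BoundedContinuousFunction X ℝ) (hL : ∀ f x, L f x = inner ℝ (k x) f) :
    IsCompactOperator L := by
  rw [isCompactOperator_iff_exists_mem_nhds_isCompact_closure_image]
  refine ⟨Metric.ball 0 1, Metric.ball_mem_nhds 0 one_pos, ?_⟩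
  -- This one inequality supplies both hypotheses of Arzelà–Ascoli: uniform boundedness (with y = 0)
  -- and equicontinuity.
  have hbound : ∀ x y : H, ∀ f ∈ Metric.ball (0 : H) 1, ‖inner ℝ x f - inner ℝ y f‖ ≤ ‖x - y‖ := by
    intro x y f hf
    rw [← inner_sub_left]
    refine (norm_inner_le_norm _ _).trans ?_
    exact mul_le_of_le_one_right (norm_nonneg _) (mem_ball_zero_iff.1 hf).le
  obtain ⟨C, hC⟩ := (isCompact_univ (X := X)).exists_bound_of_continuousOn k.continuous.continuousOn
  refine BoundedContinuousFunction.arzela_ascoli (Metric.closedBall 0 C)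
    (isCompact_closedBall _ _) _ ?_ ?_
  · rintro _ x ⟨f, hf, rfl⟩
    rw [mem_closedBall_zero_iff, hL]
    have := hbound (k x) 0 f hf
    simp only [inner_zero_left, sub_zero] at this
    exact this.trans (hC x trivial)
  · intro x
    rw [Metric.equicontinuousAt_iff_right]
    intro ε hε
    have hk : ∀ᶠ y in nhds x, ‖k x - k y‖ < ε := by
      have := Metric.tendsto_nhds.1 (k.continuous.tendsto x) ε hε
      filter_upwards [this] with y hy
      rwa [dist_comm, dist_eq_norm] at hy
    filter_upwards [hk] with y hy
    rintro ⟨_, f, hf, rfl⟩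
    simp only [hL, Real.dist_eq]
    exact (hbound (k x) (k y) f hf).trans_lt hy

/-- The map sending `z` to the indicator function of `(0, z]`. -/
def indicatorFamily : C(Set.Icc (0 : ℝ) 1, StateSpace ℝ) where
  toFun z := indicatorConstLp 2 (measurableSet_Ioc (a := 0) (b := (z : ℝ)))
    (measure_ne_top (volume.restrict (Set.Ioo (0 : ℝ) 1)) _) 1
  continuous_toFun := by
    refine continuous_indicatorConstLp_set (by simp) fun x => ?_
    have hlim : Filter.Tendsto (fun y : Set.Icc (0 : ℝ) 1 => ENNReal.ofReal |(y : ℝ) - x|)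
        (nhds x) (nhds 0) := by
      have hc : Continuous fun y : Set.Icc (0 : ℝ) 1 => ENNReal.ofReal |(y : ℝ) - x| :=
        ENNReal.continuous_ofReal.comp (by fun_prop)
      simpa using hc.tendsto x
    refine tendsto_of_tendsto_of_tendsto_of_le_of_le tendsto_const_nhds hlim
      (fun _ => zero_le) fun y => ?_
    refine (Measure.restrict_apply_le _ _).trans ?_
    rw [← Real.volume_interval]
    refine measure_mono ?_
    intro ζ hζ
    rcases le_total (x : ℝ) y with hxy | hxy
    · rw [Set.uIcc_of_le hxy]
      rcases hζ with ⟨h1, h2⟩ | ⟨h1, h2⟩ <;> simp only [Set.mem_Ioc, not_and, not_le] at h1 h2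
      · exact ⟨(h2 h1.1).le, h1.2⟩
      · exact absurd (h2 h1.1) (not_lt.2 (h1.2.trans hxy))
    · rw [Set.uIcc_of_ge hxy]
      rcases hζ with ⟨h1, h2⟩ | ⟨h1, h2⟩ <;> simp only [Set.mem_Ioc, not_and, not_le] at h1 h2
      · exact absurd (h2 h1.1) (not_lt.2 (h1.2.trans hxy))
      · exact ⟨(h2 h1.1).le, h1.2⟩

/-- Identifies the Volterra operator as a continuous family of inner products, the form to which the
compactness criterion applies. -/
theorem inner_indicatorFamily (z : Set.Icc (0 : ℝ) 1) (f : StateSpace ℝ) :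
    inner ℝ (indicatorFamily z) f = ∫ ζ in (0 : ℝ)..z, f ζ := by
  rw [intervalIntegral_eq_setIntegral_Ioo _ z.2]
  exact L2.inner_indicatorConstLp_one measurableSet_Ioc (measure_ne_top _ _) f

/-- The continuous function `z ↦ ∫₀ᶻ f` on `[0,1]`. -/
def primitiveFun (f : StateSpace ℝ) : BoundedContinuousFunction (Set.Icc (0 : ℝ) 1) ℝ :=
  BoundedContinuousFunction.mkOfCompact
    ⟨fun z => inner ℝ (indicatorFamily z) f, by fun_prop⟩

theorem primitiveFun_apply (f : StateSpace ℝ) (z : Set.Icc (0 : ℝ) 1) :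
    primitiveFun f z = inner ℝ (indicatorFamily z) f := rfl

/-- Extension of a continuous function on `[0,1]` to `ℝ`, as an element of `L²(0,1)`. -/
def extendToLp (g : BoundedContinuousFunction (Set.Icc (0 : ℝ) 1) ℝ) : StateSpace ℝ :=
  BoundedContinuousFunction.toLp (p := 2) (volume.restrict (Set.Ioo (0 : ℝ) 1)) ℝ
    (g.compContinuous ⟨Set.projIcc (0 : ℝ) 1 zero_le_one, continuous_projIcc⟩)

theorem continuous_extendToLp : Continuous extendToLp :=
  (BoundedContinuousFunction.toLp (p := 2) (volume.restrict (Set.Ioo (0 : ℝ) 1)) ℝ).continuous.comp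
    (BoundedContinuousFunction.continuous_compContinuous _)

theorem coeFn_extendToLp_primitiveFun (f : StateSpace ℝ) :
    extendToLp (primitiveFun f) =ᵐ[volume.restrict (Set.Ioo (0 : ℝ) 1)]
      fun z => ∫ ζ in (0 : ℝ)..z, f ζ := by
  have h := BoundedContinuousFunction.coeFn_toLp (p := 2) (volume.restrict (Set.Ioo (0 : ℝ) 1))
    (𝕜 := ℝ) ((primitiveFun f).compContinuous
      ⟨Set.projIcc (0 : ℝ) 1 zero_le_one, continuous_projIcc⟩)
  filter_upwards [h, self_mem_ae_restrict measurableSet_Ioo] with z hz hz1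
  refine hz.trans ?_
  simp only [BoundedContinuousFunction.compContinuous_apply, ContinuousMap.coe_mk,
    Set.projIcc_of_mem zero_le_one (Set.Ioo_subset_Icc_self hz1)]
  exact inner_indicatorFamily _ f

theorem isCompactOperator_primitive :
    IsCompactOperator fun f : StateSpace ℝ => extendToLp (primitiveFun f) :=
  (isCompactOperator_of_apply_eq_inner indicatorFamily primitiveFun
    primitiveFun_apply).continuous_comp continuous_extendToLp

/-- The Volterra operator `f ↦ ∫₀ᶻ f` on `L²(0,1)`. -/
def primitive : StateSpace ℝ →L[ℝ] StateSpace ℝ :=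
  ContinuousLinearMap.mkOfIsCompactOperator (𝕜₁ := ℝ) (𝕜₂ := ℝ) (σ₁₂ := RingHom.id ℝ)
    (f := { toFun := fun f => extendToLp (primitiveFun f)
            map_add' := fun f g => by
              have : primitiveFun (f + g) = primitiveFun f + primitiveFun g := by
                ext z; simp [primitiveFun_apply, inner_add_right]
              rw [this, extendToLp, BoundedContinuousFunction.add_compContinuous, map_add]; rfl
            map_smul' := fun c f => by
              have : primitiveFun (c • f) = c • primitiveFun f := by
                ext z; simp [primitiveFun_apply, inner_smul_right]
              have h2 (g : BoundedContinuousFunction (Set.Icc (0 : ℝ) 1) ℝ)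
                  (k : C(ℝ, Set.Icc (0 : ℝ) 1)) :
                  (c • g).compContinuous k = c • g.compContinuous k := rfl
              rw [this, extendToLp, h2, map_smul]
              rfl })
    isCompactOperator_primitive

theorem coeFn_primitive (f : StateSpace ℝ) :
    primitive f =ᵐ[volume.restrict (Set.Ioo (0 : ℝ) 1)] fun z => ∫ ζ in (0 : ℝ)..z, f ζ :=
  coeFn_extendToLp_primitiveFun f

theorem isCompactOperator_coe_primitive : IsCompactOperator primitive :=
  isCompactOperator_primitive

/-- Multiplication by a continuous function as a bounded operator on `L²(0,1)`. -/
def multiplication {m : ℝ → ℝ} (hm : ContinuousOn m (Set.Icc 0 1)) :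
    StateSpace ℝ →L[ℝ] StateSpace ℝ :=
  (ContinuousLinearMap.mul ℝ ℝ).holderL (volume.restrict (Set.Ioo (0 : ℝ) 1)) ⊤ 2 2
    (hm.memLp_Ioo_zero_one ⊤).toLp

theorem coeFn_multiplication {m : ℝ → ℝ} (hm : ContinuousOn m (Set.Icc 0 1)) (f : StateSpace ℝ) :
    multiplication hm f =ᵐ[volume.restrict (Set.Ioo (0 : ℝ) 1)] fun z => m z * f z := by
  have h1 := (ContinuousLinearMap.mul ℝ ℝ).coeFn_holder (r := 2)
    (hm.memLp_Ioo_zero_one ⊤).toLp f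
  filter_upwards [h1, (hm.memLp_Ioo_zero_one ⊤).coeFn_toLp] with z h1 h2
  refine h1.trans ?_
  rw [h2]; rfl

/-- The solution of `h'' = g`, `h(0) = s`, `h'(0) = r`. -/
theorem isH2_double_primitive (s r : ℝ) (g : StateSpace ℝ) :
    IsH2 (fun z => s + ∫ x in (0 : ℝ)..z, (r + ∫ ζ in (0 : ℝ)..x, g ζ))
      (fun z => r + ∫ ζ in (0 : ℝ)..z, g ζ) g where
  hasDeriv z hz := by
    have hg : IntegrableOn g (Set.Ioo (0 : ℝ) 1) := (Lp.memLp g).integrable one_le_two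
    exact (intervalIntegral_hasDerivWithinAt_of_continuousOn
      (continuousOn_const.add hg.continuousOn_primitive_zero_one) hz).const_add s
  memLp := Lp.memLp g
  absCont z _ := by simp

theorem coeFn_primitive_primitive (s r : ℝ) (g : StateSpace ℝ) :
    (fun z => s + r * z + primitive (primitive g) z) =ᵐ[volume.restrict (Set.Ioo (0 : ℝ) 1)]
      fun z => s + ∫ x in (0 : ℝ)..z, (r + ∫ ζ in (0 : ℝ)..x, g ζ) := by
  have hg : IntegrableOn g (Set.Ioo (0 : ℝ) 1) := (Lp.memLp g).integrable one_le_two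
  filter_upwards [coeFn_primitive (primitive g), self_mem_ae_restrict measurableSet_Ioo]
    with z h1 hz
  have hz' := Set.Ioo_subset_Icc_self hz
  have h2 : ∫ x in (0 : ℝ)..z, primitive g x =
      ∫ x in (0 : ℝ)..z, ∫ ζ in (0 : ℝ)..x, g ζ := by
    rw [intervalIntegral_eq_setIntegral_Ioo _ hz', intervalIntegral_eq_setIntegral_Ioo _ hz']
    exact integral_congr_ae (ae_restrict_of_ae (coeFn_primitive g))
  rw [h1, h2, intervalIntegral.integral_add (by simp)]
  · simp; ring
  · refine ContinuousOn.intervalIntegrable ?_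
    rw [Set.uIcc_of_le hz'.1]
    exact hg.continuousOn_primitive_zero_one.mono (Set.Icc_subset_Icc_right hz'.2)

/-! ### Initial and boundary value problems for the Robin operator. -/

section Real

variable {ρ : ℝ} {a : ℝ → ℝ} {q₀ q₁ μ : ℝ} {u : Fin 2 → ℝ} {h : ℝ → ℝ}

/-- Uniqueness for the initial value problem of the eigenvalue equation. -/
theorem RobinRel.eq_zero_of_initial (hρ : ρ ≠ 0) (ha : ContinuousOn a (Set.Icc 0 1))
    (H : RobinRel ρ a q₀ q₁ u h (fun z => μ * h z)) (hu : u 0 = 0) (h0 : h 0 = 0) :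
    ∀ z ∈ Set.Icc (0 : ℝ) 1, h z = 0 := by
  obtain ⟨h₁, h₂, H, hf, hb, -⟩ := H
  simp only [hu, h0, mul_zero, add_zero, RCLike.ofReal_real_eq_id, id_eq] at hb hf
  set m : ℝ → ℝ := fun z => (μ - a z) / ρ with hm
  have hmc : ContinuousOn m (Set.Icc 0 1) := (continuousOn_const.sub ha).div_const ρ
  -- The equation replaces `h₂` by the continuous function `m h`, so `h₁` is differentiable
  -- everywhere and Grönwall's inequality applies to the pair `(h, h₁)`.
  have hh₁ : ∀ z ∈ Set.Icc (0 : ℝ) 1, h₁ z = ∫ ζ in (0 : ℝ)..z, m ζ * h ζ := by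
    intro z hz
    rw [H.absCont z hz, hb, zero_add, intervalIntegral_eq_setIntegral_Ioo _ hz,
      intervalIntegral_eq_setIntegral_Ioo _ hz]
    refine integral_congr_ae (ae_restrict_of_ae ?_)
    filter_upwards [hf] with ζ hζ
    simp only [hm]
    field_simp
    linarith
  have hd : ∀ z ∈ Set.Icc (0 : ℝ) 1,
      HasDerivWithinAt (fun z => (h z, h₁ z)) (h₁ z, m z * h z) (Set.Icc 0 1) z := by
    intro z hz
    refine (H.hasDeriv z hz).prodMk ?_
    exact (intervalIntegral_hasDerivWithinAt_of_continuousOn (hmc.mul H.continuousOn) hz).congr hh₁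
      (hh₁ z hz)
  obtain ⟨C, hC⟩ := isCompact_Icc.exists_bound_of_continuousOn hmc
  have key := eq_zero_of_abs_deriv_le_mul_abs_self_of_eq_zero_right
    (f := fun z => (h z, h₁ z)) (f' := fun z => (h₁ z, m z * h z)) (K := max 1 C)
    (fun z hz => (hd z hz).continuousWithinAt)
    (fun z hz => (hd z (Set.Ico_subset_Icc_self hz)).mono_of_mem_nhdsWithin
      (Icc_mem_nhdsGE_of_mem hz)) (by simp [h0, hb]) ?_
  · intro z hz
    exact (Prod.mk.inj (key z hz)).1
  · intro z hz
    rw [Prod.norm_def, Prod.norm_def]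
    refine max_le ?_ ?_
    · calc ‖h₁ z‖ ≤ max ‖h z‖ ‖h₁ z‖ := le_max_right _ _
        _ ≤ max 1 C * max ‖h z‖ ‖h₁ z‖ :=
          le_mul_of_one_le_left (le_max_of_le_left (norm_nonneg _)) (le_max_left _ _)
    · rw [norm_mul]
      exact mul_le_mul ((hC z (Set.Ico_subset_Icc_self hz)).trans (le_max_right _ _))
        (le_max_left _ _) (norm_nonneg _) (le_max_of_le_left zero_le_one)

/-- The data h(0) = s, h'(0) = q₀ s build in the left boundary condition. The number d records the
defect in the right one, to be removed later by shooting. -/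
theorem robinRel_double_primitive (hρ : ρ ≠ 0) (s : ℝ) {v g f : StateSpace ℝ}
    (hv : v =ᵐ[volume.restrict (Set.Ioo (0 : ℝ) 1)]
      fun z => s + q₀ * s * z + primitive (primitive g) z)
    (hg : g =ᵐ[volume.restrict (Set.Ioo (0 : ℝ) 1)] fun z => (μ - a z) / ρ * v z - f z / ρ) :
    ∃ (h : ℝ → ℝ) (d : ℝ), v =ᵐ[volume.restrict (Set.Ioo (0 : ℝ) 1)] h ∧ h 0 = s ∧
      RobinRel ρ a q₀ q₁ ![0, d] h (fun z => μ * h z - f z) := by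
  have hvh := hv.trans (coeFn_primitive_primitive s (q₀ * s) g)
  refine ⟨_, (q₀ * s + ∫ ζ in (0 : ℝ)..1, g ζ) -
    q₁ * (s + ∫ x in (0 : ℝ)..1, (q₀ * s + ∫ ζ in (0 : ℝ)..x, g ζ)), hvh, by simp, _, _,
    isH2_double_primitive s (q₀ * s) g, ?_, ?_, ?_⟩
  · filter_upwards [hvh, hg] with z h1 h2
    rw [← h1, h2]
    simp only [RCLike.ofReal_real_eq_id, id_eq]
    field_simp
    ring
  · simp
  · simp

/-- Fredholm alternative for a compact operator: a fixed vector would solve the homogeneous equation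
with zero initial data and hence vanish, so 1 is not an eigenvalue and 1 - W is invertible. -/
theorem exists_volterra_solution (hρ : ρ ≠ 0) (ha : ContinuousOn a (Set.Icc 0 1)) (μ : ℝ)
    (hm : ContinuousOn (fun z => (μ - a z) / ρ) (Set.Icc 0 1)) (b : StateSpace ℝ) :
    ∃ v, v = primitive (primitive (multiplication hm v)) + b := by
  set W : StateSpace ℝ →L[ℝ] StateSpace ℝ := primitive ∘L primitive ∘L multiplication hm with hW
  have hWc : IsCompactOperator W :=
    isCompactOperator_coe_primitive.comp_clm (primitive ∘L multiplication hm)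
  rcases hWc.hasEigenvalue_or_mem_resolventSet one_ne_zero with h | h
  · exfalso
    obtain ⟨v, hv⟩ := h.exists_hasEigenvector
    have hWv : W v = v := by simpa using hv.apply_eq_smul
    obtain ⟨h, d, hvh, h0, H⟩ := robinRel_double_primitive (ρ := ρ) (a := a) (q₀ := 0) (q₁ := 0)
      (μ := μ) hρ 0 (v := v) (g := multiplication hm v) (f := 0)
      (by
        have : v = primitive (primitive (multiplication hm v)) := hWv.symm
        filter_upwards with z
        rw [← this]; simp)
      (by
        filter_upwards [coeFn_multiplication hm v, Lp.coeFn_zero ℝ 2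
          (volume.restrict (Set.Ioo (0 : ℝ) 1))] with z h1 h2
        rw [h1, h2]; simp)
    have H' : RobinRel ρ a 0 0 ![0, d] h (fun z => μ * h z) := by
      refine H.congr_right ?_
      filter_upwards [Lp.coeFn_zero ℝ 2 (volume.restrict (Set.Ioo (0 : ℝ) 1))] with z h2
      simp only [h2, Pi.zero_apply, sub_zero]
    have hz := H'.eq_zero_of_initial hρ ha rfl h0
    refine hv.2 ?_
    rw [Lp.eq_zero_iff_ae_eq_zero]
    filter_upwards [hvh, self_mem_ae_restrict measurableSet_Ioo] with z h1 h2
    rw [h1, hz z (Set.Ioo_subset_Icc_self h2)]; rfl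
  · rw [spectrum.mem_resolventSet_iff, map_one] at h
    obtain ⟨U, hU⟩ := h
    refine ⟨(↑U⁻¹ : StateSpace ℝ →L[ℝ] StateSpace ℝ) b, ?_⟩
    have h1 : (U : StateSpace ℝ →L[ℝ] StateSpace ℝ) ((↑U⁻¹ : StateSpace ℝ →L[ℝ] StateSpace ℝ) b)
        = b := by
      rw [← mul_apply_eq_comp, Units.mul_inv]; rfl
    rw [hU] at h1
    have h2 : (↑U⁻¹ : StateSpace ℝ →L[ℝ] StateSpace ℝ) b -
      W ((↑U⁻¹ : StateSpace ℝ →L[ℝ] StateSpace ℝ) b) = b := h1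
    exact (eq_add_of_sub_eq' h2)

/-- The initial value problem `ρ h'' + a h = μ h - f`, `h(0) = s`, `h'(0) = q₀ s`. -/
theorem exists_initial_value_solution (hρ : ρ ≠ 0) (ha : ContinuousOn a (Set.Icc 0 1))
    (q₀ q₁ μ s : ℝ) (f : StateSpace ℝ) :
    ∃ (h : ℝ → ℝ) (d : ℝ), h 0 = s ∧
      RobinRel ρ a q₀ q₁ ![0, d] h (fun z => μ * h z - f z) := by
  have hm : ContinuousOn (fun z => (μ - a z) / ρ) (Set.Icc 0 1) :=
    (continuousOn_const.sub ha).div_const ρ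
  have he : ContinuousOn (fun z : ℝ => s + q₀ * s * z) (Set.Icc 0 1) := by fun_prop
  obtain ⟨v, hv⟩ := exists_volterra_solution hρ ha μ hm
    ((he.memLp_Ioo_zero_one 2).toLp - primitive (primitive ((1 / ρ) • f)))
  set g : StateSpace ℝ := multiplication hm v - (1 / ρ) • f with hg
  have hv' : v = (he.memLp_Ioo_zero_one 2).toLp + primitive (primitive g) := by
    rw [hg, map_sub, map_sub]
    conv_lhs => rw [hv]
    abel
  have hvae : v =ᵐ[volume.restrict (Set.Ioo (0 : ℝ) 1)]
      fun z => s + q₀ * s * z + primitive (primitive g) z := by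
    rw [hv']
    filter_upwards [Lp.coeFn_add (he.memLp_Ioo_zero_one 2).toLp (primitive (primitive g)),
      (he.memLp_Ioo_zero_one 2).coeFn_toLp] with z h1 h2
    rw [h1, Pi.add_apply, h2]
  have hgae : g =ᵐ[volume.restrict (Set.Ioo (0 : ℝ) 1)]
      fun z => (μ - a z) / ρ * v z - f z / ρ := by
    filter_upwards [coeFn_multiplication hm v, Lp.coeFn_sub (multiplication hm v) ((1 / ρ) • f),
      Lp.coeFn_smul (1 / ρ) f] with z h1 h2 h3
    rw [hg, h2, Pi.sub_apply, h1, h3, Pi.smul_apply, smul_eq_mul]; ring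
  obtain ⟨h, d, -, h0, H⟩ := robinRel_double_primitive (q₁ := q₁) hρ s hvae hgae
  exact ⟨h, d, h0, H⟩

theorem ContinuousOn.eq_zero_of_ae_zero (hc : ContinuousOn h (Set.Icc 0 1))
    (h0 : h =ᵐ[volume.restrict (Set.Ioo (0 : ℝ) 1)] 0) : ∀ z ∈ Set.Icc (0 : ℝ) 1, h z = 0 := by
  rw [restrict_Ioo_eq_restrict_Icc] at h0
  exact Measure.eqOn_Icc_of_ae_eq volume zero_ne_one h0 hc continuousOn_const

/-- Eigenfunctions can be normalized. -/
theorem RobinRel.exists_isUnitEigenfunction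
    (H : RobinRel ρ a q₀ q₁ 0 h (fun z => μ * h z))
    (h0 : ¬ h =ᵐ[volume.restrict (Set.Ioo (0 : ℝ) 1)] 0) :
    ∃ ψ, IsUnitEigenfunction ρ a q₀ q₁ μ ψ := by
  have hi : IntegrableOn (fun z => h z ^ 2) (Set.Ioo (0 : ℝ) 1) := H.memLp.integrable_sq
  have hN : 0 < ∫ z in Set.Ioo (0 : ℝ) 1, h z ^ 2 := by
    refine lt_of_le_of_ne (integral_nonneg fun z => sq_nonneg _) fun hne => h0 ?_
    have := (integral_eq_zero_iff_of_nonneg (fun z => sq_nonneg (h z)) hi).1 hne.symm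
    filter_upwards [this] with z hz
    simpa using hz
  set N := ∫ z in Set.Ioo (0 : ℝ) 1, h z ^ 2 with hNdef
  refine ⟨fun z => (Real.sqrt N)⁻¹ * h z, ?_, ?_⟩
  · have := H.const_mul (Real.sqrt N)⁻¹
    rw [smul_zero] at this
    refine this.congr_right (Filter.Eventually.of_forall fun z => ?_)
    ring
  · simp_rw [mul_pow]
    rw [integral_const_mul, ← hNdef, inv_pow, Real.sq_sqrt hN.le, inv_mul_cancel₀ hN.ne']

/-- Eigenvalues of the Robin problem are simple. -/
theorem IsUnitEigenfunction.eq_const_mul (hρ : ρ ≠ 0) (ha : ContinuousOn a (Set.Icc 0 1))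
    {φ : ℝ → ℝ} (hφ : IsUnitEigenfunction ρ a q₀ q₁ μ φ)
    (H : RobinRel ρ a q₀ q₁ 0 h (fun z => μ * h z)) :
    ∃ c : ℝ, ∀ z ∈ Set.Icc (0 : ℝ) 1, h z = c * φ z := by
  -- An eigenfunction vanishing at 0 would have zero Cauchy data, contradicting its unit norm. Hence
  -- a multiple of `φ` can match `h` at 0, and uniqueness finishes.
  have hφ0 : φ 0 ≠ 0 := by
    intro h0
    have hz := hφ.1.eq_zero_of_initial hρ ha rfl h0
    have h1 := hφ.2
    rw [setIntegral_congr_fun (g := fun _ => (0 : ℝ)) measurableSet_Ioo] at h1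
    · simp at h1
    · intro z hz'
      simp [hz z (Set.Ioo_subset_Icc_self hz')]
  refine ⟨h 0 / φ 0, fun z hz => ?_⟩
  have K := H.add (hφ.1.const_mul (-(h 0 / φ 0)))
  rw [smul_zero, add_zero] at K
  have K' : RobinRel ρ a q₀ q₁ 0 (fun z => h z + -(h 0 / φ 0) * φ z)
      (fun z => μ * (h z + -(h 0 / φ 0) * φ z)) :=
    K.congr_right (Filter.Eventually.of_forall fun z => by ring)
  have := K'.eq_zero_of_initial hρ ha rfl (by field_simp; ring) z hz
  linarith

/-- Off the spectrum, the homogeneous Robin problem is solvable. -/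
theorem exists_robin_solution (hρ : ρ ≠ 0) (ha : ContinuousOn a (Set.Icc 0 1))
    (hμ : ∀ ψ, ¬ IsUnitEigenfunction ρ a q₀ q₁ μ ψ) (f : StateSpace ℝ) :
    ∃ h : ℝ → ℝ, RobinRel ρ a q₀ q₁ 0 h (fun z => μ * h z - f z) := by
  -- Shooting: `ψ` solves the homogeneous equation with right defect d, and `p` the inhomogeneous
  -- one with defect e. If d were 0, μ would be an eigenvalue; so p - (e/d) ψ satisfies both
  -- boundary conditions.
  obtain ⟨ψ, d, hψ0, Hψ⟩ := exists_initial_value_solution hρ ha q₀ q₁ μ 1 0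
  obtain ⟨p, e, -, Hp⟩ := exists_initial_value_solution hρ ha q₀ q₁ μ 0 f
  have Hψ' : RobinRel ρ a q₀ q₁ ![0, d] ψ (fun z => μ * ψ z) := by
    refine Hψ.congr_right ?_
    filter_upwards [Lp.coeFn_zero ℝ 2 (volume.restrict (Set.Ioo (0 : ℝ) 1))] with z h2
    simp only [h2, Pi.zero_apply, sub_zero]
  have hd : d ≠ 0 := by
    rintro rfl
    have h0 : (![0, 0] : Fin 2 → ℝ) = 0 := by ext i; fin_cases i <;> rfl
    rw [h0] at Hψ'
    by_cases hae : ψ =ᵐ[volume.restrict (Set.Ioo (0 : ℝ) 1)] 0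
    · have := Hψ'.continuousOn.eq_zero_of_ae_zero hae 0 (by simp)
      rw [hψ0] at this
      exact one_ne_zero this
    · obtain ⟨χ, hχ⟩ := Hψ'.exists_isUnitEigenfunction hae
      exact hμ χ hχ
  have K := Hp.add (Hψ'.const_mul (-(e / d)))
  have h0 : (![0, e] + -(e / d) • ![0, d] : Fin 2 → ℝ) = 0 := by
    ext i; fin_cases i <;> simp [hd]
  rw [h0] at K
  exact ⟨_, K.congr_right (Filter.Eventually.of_forall fun z => by simp only; ring)⟩

end Real

/-! ### The compact symmetric resolvent and completeness of the eigenfunctions. -/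

section Resolvent

variable {ρ : ℝ} {a : ℝ → ℝ} {q₀ q₁ μ : ℝ}

/-- `v` solves `(μ - 𝒜) v = f`. -/
def IsResolvent (ρ : ℝ) (a : ℝ → ℝ) (q₀ q₁ μ : ℝ) (f v : StateSpace ℝ) : Prop :=
  ∃ h : ℝ → ℝ, v =ᵐ[volume.restrict (Set.Ioo (0 : ℝ) 1)] h ∧
    RobinRel ρ a q₀ q₁ 0 h (fun z => μ * h z - f z)

namespace IsResolvent

variable {f g v w : StateSpace ℝ}

theorem exists_of_not_eigenvalue (hρ : ρ ≠ 0) (ha : ContinuousOn a (Set.Icc 0 1))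
    (hμ : ∀ ψ, ¬ IsUnitEigenfunction ρ a q₀ q₁ μ ψ) (f : StateSpace ℝ) :
    ∃ v, IsResolvent ρ a q₀ q₁ μ f v := by
  obtain ⟨h, H⟩ := exists_robin_solution hρ ha hμ f
  exact ⟨H.memLp.toLp, h, H.memLp.coeFn_toLp, H⟩

theorem add (hv : IsResolvent ρ a q₀ q₁ μ f v) (hw : IsResolvent ρ a q₀ q₁ μ g w) :
    IsResolvent ρ a q₀ q₁ μ (f + g) (v + w) := by
  obtain ⟨h, hvh, H⟩ := hv
  obtain ⟨k, hwk, K⟩ := hw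
  refine ⟨_, (Lp.coeFn_add v w).trans (hvh.add hwk), ?_⟩
  have := H.add K
  rw [add_zero] at this
  refine this.congr_right ?_
  filter_upwards [Lp.coeFn_add f g] with z hz
  simp only [hz, Pi.add_apply]; ring

theorem smul (c : ℝ) (hv : IsResolvent ρ a q₀ q₁ μ f v) :
    IsResolvent ρ a q₀ q₁ μ (c • f) (c • v) := by
  obtain ⟨h, hvh, H⟩ := hv
  refine ⟨_, (Lp.coeFn_smul c v).trans (hvh.const_smul c), ?_⟩
  have := H.const_mul c
  rw [smul_zero] at this
  refine this.congr_right ?_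
  filter_upwards [Lp.coeFn_smul c f] with z hz
  simp only [hz, Pi.smul_apply, smul_eq_mul]; ring

theorem eq_zero (hμ : ∀ ψ, ¬ IsUnitEigenfunction ρ a q₀ q₁ μ ψ)
    (hv : IsResolvent ρ a q₀ q₁ μ 0 v) : v = 0 := by
  obtain ⟨h, hvh, H⟩ := hv
  have H' : RobinRel ρ a q₀ q₁ 0 h (fun z => μ * h z) := by
    refine H.congr_right ?_
    filter_upwards [Lp.coeFn_zero ℝ 2 (volume.restrict (Set.Ioo (0 : ℝ) 1))] with z h2
    simp only [h2, Pi.zero_apply, sub_zero]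
  by_contra hne
  refine hne ((Lp.eq_zero_iff_ae_eq_zero).2 (hvh.trans ?_))
  by_contra hae
  obtain ⟨ψ, hψ⟩ := H'.exists_isUnitEigenfunction hae
  exact hμ ψ hψ

theorem unique (hμ : ∀ ψ, ¬ IsUnitEigenfunction ρ a q₀ q₁ μ ψ)
    (hv : IsResolvent ρ a q₀ q₁ μ f v) (hw : IsResolvent ρ a q₀ q₁ μ f w) : v = w := by
  have := hv.add (hw.smul (-1))
  rw [neg_one_smul, neg_one_smul, add_neg_cancel] at this
  exact add_neg_eq_zero.1 (this.eq_zero hμ)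

/-- Green's formula without boundary terms; the two contributions of μ cancel. This is the symmetry
of the resolvent. -/
theorem inner_eq (ha : ContinuousOn a (Set.Icc 0 1)) (hv : IsResolvent ρ a q₀ q₁ μ f v)
    (hw : IsResolvent ρ a q₀ q₁ μ g w) : inner ℝ v g = inner ℝ f w := by
  obtain ⟨h, hvh, H⟩ := hv
  obtain ⟨k, hwk, K⟩ := hw
  have hG := H.green ha K
  simp only [Pi.zero_apply, zero_mul, sub_zero, add_zero, mul_zero] at hG
  have hhk : IntegrableOn (fun z => μ * (h z * k z)) (Set.Ioo (0 : ℝ) 1) :=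
    (H.memLp.integrable_mul K.memLp).const_mul μ
  have hfk : IntegrableOn (fun z => f z * k z) (Set.Ioo (0 : ℝ) 1) :=
    (Lp.memLp f).integrable_mul K.memLp
  have hhg : IntegrableOn (fun z => h z * g z) (Set.Ioo (0 : ℝ) 1) :=
    H.memLp.integrable_mul (Lp.memLp g)
  have e1 : ∫ z in Set.Ioo (0 : ℝ) 1, (μ * h z - f z) * k z =
      (∫ z in Set.Ioo (0 : ℝ) 1, μ * (h z * k z)) - ∫ z in Set.Ioo (0 : ℝ) 1, f z * k z := by
    rw [← integral_sub hhk hfk]; congr 1; ext z; ring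
  have e2 : ∫ z in Set.Ioo (0 : ℝ) 1, h z * (μ * k z - g z) =
      (∫ z in Set.Ioo (0 : ℝ) 1, μ * (h z * k z)) - ∫ z in Set.Ioo (0 : ℝ) 1, h z * g z := by
    rw [← integral_sub hhk hhg]; congr 1; ext z; ring
  rw [e1, e2] at hG
  have e3 : inner ℝ v g = ∫ z in Set.Ioo (0 : ℝ) 1, h z * g z := by
    rw [L2.inner_def]
    refine integral_congr_ae ?_
    filter_upwards [hvh] with z hz
    simp [hz, mul_comm]
  have e4 : inner ℝ f w = ∫ z in Set.Ioo (0 : ℝ) 1, f z * k z := by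
    rw [L2.inner_def]
    refine integral_congr_ae ?_
    filter_upwards [hwk] with z hz
    simp [hz, mul_comm]
  rw [e3, e4]
  linarith

/-- Injectivity of the resolvent: a continuous representative that is zero a.e. is zero, hence so is
its derivative, and Lebesgue differentiation kills `h₂`. -/
theorem eq_zero_of_left (hv : IsResolvent ρ a q₀ q₁ μ f 0) : f = 0 := by
  obtain ⟨h, hvh, H⟩ := hv
  have hz : ∀ z ∈ Set.Icc (0 : ℝ) 1, h z = 0 :=
    H.continuousOn.eq_zero_of_ae_zero (hvh.symm.trans (Lp.coeFn_zero _ _ _))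
  obtain ⟨h₁, h₂, H, hf, -⟩ := H
  have hz₁ : ∀ z ∈ Set.Icc (0 : ℝ) 1, h₁ z = 0 := by
    intro z hz'
    have hd := (hasDerivWithinAt_const z (Set.Icc (0 : ℝ) 1) (0 : ℝ)).congr hz (hz z hz')
    exact (uniqueDiffOn_Icc (zero_lt_one' ℝ) z hz').eq_deriv _ (H.hasDeriv z hz') hd
  have hint : ∀ z ∈ Set.Icc (0 : ℝ) 1, ∫ ζ in (0 : ℝ)..z, h₂ ζ = 0 := by
    intro z hz'
    have := H.absCont z hz'
    rw [hz₁ z hz', hz₁ 0 (by simp)] at this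
    linarith
  have hI : IntervalIntegrable h₂ volume 0 1 :=
    H.integrableOn.intervalIntegrable_of_Ioo_zero_one (by simp) (by simp)
  have hae : h₂ =ᵐ[volume.restrict (Set.Ioo (0 : ℝ) 1)] 0 := by
    filter_upwards [ae_restrict_of_ae hI.ae_hasDerivAt_integral,
      self_mem_ae_restrict measurableSet_Ioo] with z hd hz'
    have hz'' := Set.Ioo_subset_Icc_self hz'
    have hd := hd (by rwa [Set.uIcc_of_le (zero_le_one' ℝ)]) 0 (by simp)
    have h0 : HasDerivAt (fun z => ∫ ζ in (0 : ℝ)..z, h₂ ζ) 0 z := by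
      refine (hasDerivAt_const z (0 : ℝ)).congr_of_eventuallyEq ?_
      filter_upwards [Icc_mem_nhds hz'.1 hz'.2] with w hw using hint w hw
    exact hd.unique h0
  refine (Lp.eq_zero_iff_ae_eq_zero).2 ?_
  filter_upwards [hf, hae, self_mem_ae_restrict measurableSet_Ioo] with z h1 h2 h3
  rw [hz z (Set.Ioo_subset_Icc_self h3), h2] at h1
  simpa using h1

/-- Integral form of the boundary value problem. -/
theorem exists_eq_smul_add (hρ : ρ ≠ 0) (ha : ContinuousOn a (Set.Icc 0 1))
    (he : MemLp (fun z : ℝ => 1 + q₀ * z) 2 (volume.restrict (Set.Ioo (0 : ℝ) 1)))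
    (hv : IsResolvent ρ a q₀ q₁ μ f v) :
    ∃ s : ℝ, v = s • he.toLp +
      primitive (primitive ((1 / ρ) • (μ • v - multiplication ha v - f))) := by
  obtain ⟨h, hvh, H⟩ := hv
  obtain ⟨h₁, h₂, H, hf, hb, -⟩ := H
  set g : StateSpace ℝ := (1 / ρ) • (μ • v - multiplication ha v - f) with hg
  simp only [RCLike.ofReal_real_eq_id, id_eq, Pi.zero_apply, add_zero] at hf hb
  have hgh : g =ᵐ[volume.restrict (Set.Ioo (0 : ℝ) 1)] h₂ := by
    filter_upwards [hf, hvh, coeFn_multiplication ha v, Lp.coeFn_smul μ v,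
      Lp.coeFn_smul (1 / ρ) (μ • v - multiplication ha v - f),
      Lp.coeFn_sub (μ • v - multiplication ha v) f, Lp.coeFn_sub (μ • v) (multiplication ha v)]
      with z h1 h2 h3 h4 h5 h6 h7
    rw [hg, h5, Pi.smul_apply, h6, Pi.sub_apply, h7, Pi.sub_apply, h3, h4, Pi.smul_apply, h2,
      smul_eq_mul, smul_eq_mul]
    field_simp
    linarith
  refine ⟨h 0, Lp.ext ?_⟩
  have hJ := coeFn_primitive_primitive (h 0) (q₀ * h 0) g
  filter_upwards [hvh, hJ, Lp.coeFn_add (h 0 • he.toLp) (primitive (primitive g)),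
    Lp.coeFn_smul (h 0) he.toLp, he.coeFn_toLp, self_mem_ae_restrict measurableSet_Ioo]
    with z h1 h2 h3 h4 h5 h6
  have hz := Set.Ioo_subset_Icc_self h6
  have e1 : ∫ x in (0 : ℝ)..z, (q₀ * h 0 + ∫ ζ in (0 : ℝ)..x, g ζ) =
      ∫ x in (0 : ℝ)..z, h₁ x := by
    refine intervalIntegral.integral_congr fun x hx => ?_
    rw [Set.uIcc_of_le hz.1] at hx
    have hx' : x ∈ Set.Icc (0 : ℝ) 1 := ⟨hx.1, hx.2.trans hz.2⟩
    rw [H.absCont x hx', hb, intervalIntegral_eq_setIntegral_Ioo _ hx',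
      intervalIntegral_eq_setIntegral_Ioo _ hx']
    congr 1
    exact integral_congr_ae (ae_restrict_of_ae hgh)
  rw [e1, H.integral_deriv (by simp) hz hz.1] at h2
  rw [h1, h3, Pi.add_apply, h4, Pi.smul_apply, h5, smul_eq_mul]
  linarith

end IsResolvent

/-- The resolvent of the Robin operator is a compact symmetric operator. -/
theorem exists_resolvent (hρ : ρ ≠ 0) (ha : ContinuousOn a (Set.Icc 0 1))
    (hμ : ∀ ψ, ¬ IsUnitEigenfunction ρ a q₀ q₁ μ ψ) :
    ∃ T : StateSpace ℝ →L[ℝ] StateSpace ℝ, IsCompactOperator T ∧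
      (T : StateSpace ℝ →ₗ[ℝ] StateSpace ℝ).IsSymmetric ∧
      ∀ f, IsResolvent ρ a q₀ q₁ μ f (T f) := by
  choose R hR using IsResolvent.exists_of_not_eigenvalue (q₀ := q₀) (q₁ := q₁) (μ := μ) hρ ha hμ
  let T₀ : StateSpace ℝ →ₗ[ℝ] StateSpace ℝ :=
    { toFun := R
      map_add' := fun f g => (hR _).unique hμ ((hR f).add (hR g))
      map_smul' := fun c f => (hR _).unique hμ ((hR f).smul c) }
  have hsymm : T₀.IsSymmetric := fun f g => (hR f).inner_eq ha (hR g)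
  -- Boundedness comes for free from symmetry (Hellinger–Toeplitz).
  let T : StateSpace ℝ →L[ℝ] StateSpace ℝ := ⟨T₀, hsymm.continuous⟩
  refine ⟨T, ?_, hsymm, hR⟩
  have he : MemLp (fun z : ℝ => 1 + q₀ * z) 2 (volume.restrict (Set.Ioo (0 : ℝ) 1)) :=
    ContinuousOn.memLp_Ioo_zero_one (by fun_prop) 2
  let S : StateSpace ℝ →L[ℝ] StateSpace ℝ :=
    (1 / ρ) • (μ • T - multiplication ha ∘L T - ContinuousLinearMap.id ℝ _)
  let V : StateSpace ℝ →L[ℝ] StateSpace ℝ := primitive ∘L primitive ∘L S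
  have hV : IsCompactOperator V := isCompactOperator_coe_primitive.comp_clm (primitive ∘L S)
  -- By the integral form, T differs from the compact V by an operator with values in the line
  -- spanned by 1 + q₀ z.
  have hmem : ∀ f, (T - V) f ∈ Submodule.span ℝ {he.toLp} := by
    intro f
    obtain ⟨s, hs⟩ := (hR f).exists_eq_smul_add hρ ha he
    refine Submodule.mem_span_singleton.2 ⟨s, ?_⟩
    have : V f = primitive (primitive ((1 / ρ) • (μ • R f - multiplication ha (R f) - f))) := rfl
    rw [sub_apply, this]
    exact (sub_eq_of_eq_add hs).symm
  have hfin : IsCompactOperator (T - V) := by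
    have : ProperSpace (Submodule.span ℝ {he.toLp}) := FiniteDimensional.proper ℝ _
    let W : StateSpace ℝ →L[ℝ] Submodule.span ℝ {he.toLp} := (T - V).codRestrict _ hmem
    have h1 : IsCompactOperator W := isCompactOperator_of_locallyCompactSpace_dom W
    exact h1.clm_comp (Submodule.span ℝ {he.toLp}).subtypeL
  have hTV : (T : StateSpace ℝ → StateSpace ℝ) = ⇑(T - V) + ⇑V := by
    funext f
    simp
  rw [hTV]
  exact hfin.add hV

/-- Completeness of the eigenfunctions of the Robin problem. -/
theorem IsEigenSequence.eq_zero_of_forall_integral_eq_zero (hρ : ρ ≠ 0)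
    (ha : ContinuousOn a (Set.Icc 0 1)) {lam : ℕ → ℝ} {φ : ℕ → ℝ → ℝ}
    (hφ : IsEigenSequence ρ a q₀ q₁ lam φ) (f : StateSpace ℝ)
    (hf : ∀ i, ∫ z in Set.Ioo (0 : ℝ) 1, f z * φ i z = 0) : f = 0 := by
  have hμ : ∀ ψ, ¬ IsUnitEigenfunction ρ a q₀ q₁ (lam 0 + 1) ψ := by
    intro ψ hψ
    obtain ⟨i, hi⟩ := hφ.exhaust _ _ hψ
    have := hφ.strictAnti.antitone (Nat.zero_le i)
    linarith
  -- By the spectral theorem the eigenspaces of T span a dense subspace, so it suffices that f is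
  -- orthogonal to each eigenvector.
  obtain ⟨T, hTc, hTs, hT⟩ := exists_resolvent hρ ha hμ
  have hbot := ContinuousLinearMap.orthogonalComplement_iSup_eigenspaces_eq_bot hTc hTs
  rw [← Submodule.mem_bot (R := ℝ), ← hbot, Submodule.mem_orthogonal]
  suffices h : (⨆ θ, Module.End.eigenspace (T : Module.End ℝ (StateSpace ℝ)) θ) ≤
      (Submodule.span ℝ {f})ᗮ by
    intro u hu
    have := (Submodule.mem_orthogonal _ _).1 (h hu) f (Submodule.mem_span_singleton_self f)
    rwa [real_inner_comm] at this
  refine iSup_le fun θ v hv => ?_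
  rw [Submodule.mem_orthogonal_singleton_iff_inner_right]
  have hTv : T v = θ • v := Module.End.mem_eigenspace_iff.1 hv
  obtain rfl | hv0 := eq_or_ne v 0
  · simp
  have hθ : θ ≠ 0 := by
    rintro rfl
    refine hv0 (IsResolvent.eq_zero_of_left (ρ := ρ) (a := a) (q₀ := q₀) (q₁ := q₁)
      (μ := lam 0 + 1) ?_)
    have := hT v
    rwa [hTv, zero_smul] at this
  obtain ⟨h, hvh, H⟩ := hT v
  have hvh' : h =ᵐ[volume.restrict (Set.Ioo (0 : ℝ) 1)] fun z => θ * v z := by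
    rw [hTv] at hvh
    filter_upwards [hvh, Lp.coeFn_smul θ v] with z h1 h2
    rw [← h1, h2]; rfl
  -- An eigenvector of T for θ is an eigenfunction for λ = μ - 1/θ. By exhaustion and simplicity it
  -- is a multiple of some `φ i`.
  have H' : RobinRel ρ a q₀ q₁ 0 h (fun z => (lam 0 + 1 - θ⁻¹) * h z) := by
    refine H.congr_right ?_
    filter_upwards [hvh'] with z h1
    rw [h1]; field_simp
  have hne : ¬ h =ᵐ[volume.restrict (Set.Ioo (0 : ℝ) 1)] 0 := by
    intro h0
    refine hv0 ((Lp.eq_zero_iff_ae_eq_zero).2 ?_)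
    filter_upwards [hvh', h0] with z h1 h2
    rw [h2] at h1
    simpa [hθ] using h1.symm
  obtain ⟨ψ, hψ⟩ := H'.exists_isUnitEigenfunction hne
  obtain ⟨i, hi⟩ := hφ.exhaust _ _ hψ
  rw [← hi] at H'
  obtain ⟨c, hc⟩ := (hφ.eigen i).eq_const_mul hρ ha H'
  rw [L2.inner_def]
  have : ∀ᵐ z ∂(volume.restrict (Set.Ioo (0 : ℝ) 1)),
      inner ℝ (f z) (v z) = c * θ⁻¹ * (f z * φ i z) := by
    filter_upwards [hvh', self_mem_ae_restrict measurableSet_Ioo] with z h1 h2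
    rw [hc z (Set.Ioo_subset_Icc_self h2)] at h1
    have : v z = θ⁻¹ * (c * φ i z) := by rw [h1]; field_simp
    simp only [this, RCLike.inner_apply, conj_trivial]
    ring
  rw [integral_congr_ae this, integral_const_mul, hf i, mul_zero]

end Resolvent

/-! ### The eigenfunction basis and the modal form of the plant. -/

section Modes

variable {𝕜 : Type*} [RCLike 𝕜] {ρ : ℝ} {a : ℝ → ℝ} {q₀ q₁ : ℝ}

theorem RobinRel.ofReal_zero {h f : ℝ → ℝ} (H : RobinRel ρ a q₀ q₁ 0 h f) :
    RobinRel ρ a q₀ q₁ (0 : Fin 2 → 𝕜) (fun z => (h z : 𝕜)) (fun z => (f z : 𝕜)) := by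
  have h0 : (fun i => (((0 : Fin 2 → ℝ) i : ℝ) : 𝕜)) = 0 := by ext i; simp
  have := H.ofReal (𝕜 := 𝕜)
  rwa [h0] at this

/-- The modal equation, obtained by testing with an eigenfunction. -/
theorem RobinRel.eigenfunctional_eq (ha : ContinuousOn a (Set.Icc 0 1)) {μ : ℝ} {φ : ℝ → ℝ}
    (hφ : IsUnitEigenfunction ρ a q₀ q₁ μ φ) {u : Fin 2 → 𝕜} {h : ℝ → 𝕜} {x y : StateSpace 𝕜}
    (hx : x =ᵐ[volume.restrict (Set.Ioo (0 : ℝ) 1)] h) (H : RobinRel ρ a q₀ q₁ u h y) :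
    eigenfunctional φ y = (μ : 𝕜) * eigenfunctional φ x +
      (ρ : 𝕜) * (u 1 * (φ 1 : 𝕜) - u 0 * (φ 0 : 𝕜)) := by
  have hG := H.green ha (hφ.1.ofReal_zero (𝕜 := 𝕜))
  simp only [Pi.zero_apply, zero_mul, sub_zero, add_zero] at hG
  rw [eigenfunctional, hG, eigenfunctional, ← integral_const_mul]
  congr 1
  refine integral_congr_ae ?_
  filter_upwards [hx] with z hz
  rw [hz]; push_cast; ring

/-- The element of `L²(0,1)` defined by an eigenfunction. -/
def IsUnitEigenfunction.toState (𝕜 : Type*) [RCLike 𝕜] {μ : ℝ} {φ : ℝ → ℝ}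
    (hφ : IsUnitEigenfunction ρ a q₀ q₁ μ φ) : StateSpace 𝕜 :=
  (hφ.1.ofReal_zero (𝕜 := 𝕜)).memLp.toLp

theorem IsUnitEigenfunction.inner_toState {μ : ℝ} {φ : ℝ → ℝ}
    (hφ : IsUnitEigenfunction ρ a q₀ q₁ μ φ) (x : StateSpace 𝕜) :
    inner 𝕜 (hφ.toState 𝕜) x = eigenfunctional φ x := by
  rw [L2.inner_def, eigenfunctional]
  refine integral_congr_ae ?_
  filter_upwards [(hφ.1.ofReal_zero (𝕜 := 𝕜)).memLp.coeFn_toLp] with z hz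
  rw [IsUnitEigenfunction.toState, hz, RCLike.inner_apply, RCLike.conj_ofReal]

theorem IsUnitEigenfunction.eigenfunctional_toState {μ : ℝ} {φ ψ : ℝ → ℝ}
    (hφ : IsUnitEigenfunction ρ a q₀ q₁ μ φ) :
    eigenfunctional ψ (hφ.toState 𝕜) =
      ((∫ z in Set.Ioo (0 : ℝ) 1, φ z * ψ z : ℝ) : 𝕜) := by
  rw [eigenfunctional, ← integral_ofReal]
  refine integral_congr_ae ?_
  filter_upwards [(hφ.1.ofReal_zero (𝕜 := 𝕜)).memLp.coeFn_toLp] with z hz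
  rw [IsUnitEigenfunction.toState, hz, RCLike.ofReal_mul]

variable {lam : ℕ → ℝ} {φ : ℕ → ℝ → ℝ}

namespace IsEigenSequence

/-- Green's formula gives (λ_j - λ_i) ∫ φ_j φ_i = 0, and the eigenvalues are distinct. -/
theorem orthonormal (ha : ContinuousOn a (Set.Icc 0 1))
    (hφ : IsEigenSequence ρ a q₀ q₁ lam φ) :
    Orthonormal 𝕜 fun i => (hφ.eigen i).toState 𝕜 := by
  classical
  rw [orthonormal_iff_ite]
  intro i j
  rw [IsUnitEigenfunction.inner_toState,
    IsUnitEigenfunction.eigenfunctional_toState]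
  split_ifs with hij
  · subst hij
    have := (hφ.eigen i).2
    simp_rw [pow_two] at this
    rw [this, RCLike.ofReal_one]
  · have hG := (hφ.eigen j).1.green ha (hφ.eigen i).1
    simp only [Pi.zero_apply, zero_mul, sub_zero, add_zero, mul_zero] at hG
    have e1 : ∀ z, lam j * φ j z * φ i z = lam j * (φ j z * φ i z) := fun z => by ring
    have e2 : ∀ z, φ j z * (lam i * φ i z) = lam i * (φ j z * φ i z) := fun z => by ring
    simp_rw [e1, e2, integral_const_mul] at hG
    have hne : lam j - lam i ≠ 0 := sub_ne_zero.2 fun h => hij (hφ.strictAnti.injective h.symm)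
    have : (lam j - lam i) * ∫ z in Set.Ioo (0 : ℝ) 1, φ j z * φ i z = 0 := by linarith
    rw [(mul_eq_zero.1 this).resolve_left hne, RCLike.ofReal_zero]

/-- Since the eigenfunctions are real, the real and imaginary parts of x are separately orthogonal
to all of them, which reduces the claim to real completeness. -/
theorem eq_zero_of_eigenfunctional_eq_zero (hρ : ρ ≠ 0) (ha : ContinuousOn a (Set.Icc 0 1))
    (hφ : IsEigenSequence ρ a q₀ q₁ lam φ) {x : StateSpace 𝕜}
    (hx : ∀ i, eigenfunctional (φ i) x = 0) : x = 0 := by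
  have hint : ∀ i, IntegrableOn (fun z => x z * (φ i z : 𝕜)) (Set.Ioo (0 : ℝ) 1) := fun i =>
    (Lp.memLp x).integrable_mul ((hφ.eigen i).1.ofReal_zero (𝕜 := 𝕜)).memLp
  have hre := hφ.eq_zero_of_forall_integral_eq_zero hρ ha (Lp.memLp x).re.toLp fun i => by
    have h1 : ∫ z in Set.Ioo (0 : ℝ) 1, RCLike.re (x z * (φ i z : 𝕜)) = 0 := by
      rw [integral_re (hint i)]
      have := hx i
      rw [eigenfunctional] at this
      rw [this, map_zero]
    refine (integral_congr_ae ?_).trans h1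
    filter_upwards [(Lp.memLp x).re.coeFn_toLp] with z hz
    rw [hz, mul_comm, mul_comm (x z), RCLike.re_ofReal_mul]
  have him := hφ.eq_zero_of_forall_integral_eq_zero hρ ha (Lp.memLp x).im.toLp fun i => by
    have h1 : ∫ z in Set.Ioo (0 : ℝ) 1, RCLike.im (x z * (φ i z : 𝕜)) = 0 := by
      rw [integral_im (hint i)]
      have := hx i
      rw [eigenfunctional] at this
      rw [this, map_zero]
    refine (integral_congr_ae ?_).trans h1
    filter_upwards [(Lp.memLp x).im.coeFn_toLp] with z hz
    rw [hz, mul_comm, mul_comm (x z), RCLike.im_ofReal_mul]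
  rw [Lp.eq_zero_iff_ae_eq_zero] at hre him ⊢
  filter_upwards [hre, him, (Lp.memLp x).re.coeFn_toLp, (Lp.memLp x).im.coeFn_toLp]
    with z h1 h2 h3 h4
  rw [h3] at h1
  rw [h4] at h2
  exact RCLike.ext (by simpa using h1) (by simpa using h2)

/-- The normalized eigenfunctions form a Hilbert basis. -/
theorem exists_hilbertBasis (𝕜 : Type*) [RCLike 𝕜] (hρ : ρ ≠ 0)
    (ha : ContinuousOn a (Set.Icc 0 1)) (hφ : IsEigenSequence ρ a q₀ q₁ lam φ) :
    ∃ b : HilbertBasis ℕ 𝕜 (StateSpace 𝕜), ∀ x i, b.repr x i = eigenfunctional (φ i) x := by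
  refine ⟨HilbertBasis.mkOfOrthogonalEqBot (hφ.orthonormal (𝕜 := 𝕜) ha) ?_, fun x i => ?_⟩
  · rw [Submodule.eq_bot_iff]
    intro x hx
    refine hφ.eq_zero_of_eigenfunctional_eq_zero hρ ha fun i => ?_
    rw [← (hφ.eigen i).inner_toState]
    exact (Submodule.mem_orthogonal _ _).1 hx _ (Submodule.subset_span ⟨i, rfl⟩)
  · rw [HilbertBasis.repr_apply_apply, HilbertBasis.coe_mkOfOrthogonalEqBot,
      IsUnitEigenfunction.inner_toState]

end IsEigenSequence

/-- Every boundary datum over `𝕜` has an `H²` lift. -/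
theorem exists_robin_lift_rclike (ρ : ℝ) (a : ℝ → ℝ) (q₀ q₁ : ℝ) (u : Fin 2 → 𝕜) :
    ∃ h f : ℝ → 𝕜, RobinRel ρ a q₀ q₁ u h f := by
  obtain ⟨g, f, H⟩ := exists_robin_lift ρ a q₀ q₁ ![1, 0]
  obtain ⟨k, e, K⟩ := exists_robin_lift ρ a q₀ q₁ ![0, 1]
  have L := ((H.ofReal (𝕜 := 𝕜)).const_mul (u 0)).add ((K.ofReal (𝕜 := 𝕜)).const_mul (u 1))
  have hu : (u 0 • fun i => ((![1, 0] : Fin 2 → ℝ) i : 𝕜)) +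
      (u 1 • fun i => ((![0, 1] : Fin 2 → ℝ) i : 𝕜)) = u := by
    ext i; fin_cases i <;> simp
  rw [hu] at L
  exact ⟨_, _, L⟩

/-- Solvability of the inhomogeneous Robin boundary value problem. -/
theorem exists_inhomogeneous_robin_solution (hρ : ρ ≠ 0) (ha : ContinuousOn a (Set.Icc 0 1))
    {μ : ℝ} (hμ : ∀ ψ, ¬ IsUnitEigenfunction ρ a q₀ q₁ μ ψ) (u : Fin 2 → 𝕜)
    (F : StateSpace 𝕜) :
    ∃ h : ℝ → 𝕜, RobinRel ρ a q₀ q₁ u h (fun z => (μ : 𝕜) * h z - F z) := by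
  obtain ⟨g, f, L⟩ := exists_robin_lift_rclike ρ a q₀ q₁ u
  have hF : MemLp (fun z => F z - ((μ : 𝕜) * g z - f z)) 2
      (volume.restrict (Set.Ioo (0 : ℝ) 1)) :=
    (Lp.memLp F).sub ((L.memLp.const_mul _).sub (L.memLp_right ha))
  -- After subtraction of the lift `g` the boundary data are zero, and the real and imaginary parts
  -- are solved separately.
  obtain ⟨h, H⟩ := exists_robin_solution hρ ha hμ hF.re.toLp
  obtain ⟨k, K⟩ := exists_robin_solution hρ ha hμ hF.im.toLp
  have S := ((H.ofReal_zero (𝕜 := 𝕜)).add ((K.ofReal_zero (𝕜 := 𝕜)).const_mul RCLike.I)).add L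
  rw [smul_zero, add_zero, zero_add] at S
  refine ⟨_, S.congr_right ?_⟩
  filter_upwards [hF.re.coeFn_toLp, hF.im.coeFn_toLp] with z h1 h2
  rw [h1, h2]
  have := RCLike.re_add_im (F z - ((μ : 𝕜) * g z - f z))
  push_cast
  linear_combination -this

namespace IsEigenSequence

theorem exists_not_eigenvalue (hφ : IsEigenSequence ρ a q₀ q₁ lam φ) :
    ∃ μ, ∀ ψ, ¬ IsUnitEigenfunction ρ a q₀ q₁ μ ψ := by
  refine ⟨lam 0 + 1, fun ψ hψ => ?_⟩
  obtain ⟨i, hi⟩ := hφ.exhaust _ _ hψ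
  have := hφ.strictAnti.antitone (Nat.zero_le i)
  linarith

/-- The modal equations characterize the Robin boundary value problem. -/
theorem exists_robinRel_of_modal (hρ : ρ ≠ 0) (ha : ContinuousOn a (Set.Icc 0 1))
    (hφ : IsEigenSequence ρ a q₀ q₁ lam φ) {x y : StateSpace 𝕜} {u : Fin 2 → 𝕜}
    (hxy : ∀ i, eigenfunctional (φ i) y = (lam i : 𝕜) * eigenfunctional (φ i) x +
      (ρ : 𝕜) * (u 1 * (φ i 1 : 𝕜) - u 0 * (φ i 0 : 𝕜))) :
    ∃ h : ℝ → 𝕜, x =ᵐ[volume.restrict (Set.Ioo (0 : ℝ) 1)] h ∧ RobinRel ρ a q₀ q₁ u h y := by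
  obtain ⟨μ, hμ⟩ := hφ.exists_not_eigenvalue
  obtain ⟨b, hb⟩ := hφ.exists_hilbertBasis 𝕜 hρ ha
  -- The candidate solves the boundary value problem with right side μ x - y. Each mode of its
  -- difference to x is annihilated by μ - λ_i ≠ 0, so it represents x.
  obtain ⟨h, H⟩ := exists_inhomogeneous_robin_solution hρ ha hμ u ((μ : 𝕜) • x - y)
  set v : StateSpace 𝕜 := H.memLp.toLp with hv
  have hvh : v =ᵐ[volume.restrict (Set.Ioo (0 : ℝ) 1)] h := H.memLp.coeFn_toLp
  have H' : RobinRel ρ a q₀ q₁ u h ((μ : 𝕜) • (v - x) + y : StateSpace 𝕜) := by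
    refine H.congr_right ?_
    filter_upwards [hvh, Lp.coeFn_add ((μ : 𝕜) • (v - x)) y, Lp.coeFn_smul (μ : 𝕜) (v - x),
      Lp.coeFn_sub v x, Lp.coeFn_sub ((μ : 𝕜) • x) y, Lp.coeFn_smul (μ : 𝕜) x]
      with z h1 h2 h3 h4 h5 h6
    rw [h2, Pi.add_apply, h3, Pi.smul_apply, h4, Pi.sub_apply, h5, Pi.sub_apply, h6,
      Pi.smul_apply, h1, smul_eq_mul, smul_eq_mul]
    ring
  have hvx : v - x = 0 := by
    refine hφ.eq_zero_of_eigenfunctional_eq_zero hρ ha fun i => ?_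
    have e := H'.eigenfunctional_eq ha (hφ.eigen i) hvh
    have e' := hxy i
    simp only [← hb, map_add, map_smul, map_sub, lp.coeFn_add, lp.coeFn_smul, lp.coeFn_sub,
      Pi.add_apply, Pi.smul_apply, Pi.sub_apply, smul_eq_mul] at e e' ⊢
    have hne : ((μ - lam i : ℝ) : 𝕜) ≠ 0 := by
      rw [RCLike.ofReal_ne_zero, sub_ne_zero]
      rintro rfl
      exact hμ _ (hφ.eigen i)
    refine (mul_eq_zero.1 (?_ : ((μ - lam i : ℝ) : 𝕜) * _ = 0)).resolve_left hne
    push_cast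
    linear_combination e - e'
  rw [hvx, smul_zero, zero_add] at H'
  rw [sub_eq_zero] at hvx
  exact ⟨h, hvx ▸ hvh, H'⟩

end IsEigenSequence

theorem HilbertBasis.hasSum_norm_sq_repr {ι H : Type*} [NormedAddCommGroup H]
    [InnerProductSpace 𝕜 H] (b : HilbertBasis ι 𝕜 H) (x : H) :
    HasSum (fun i => ‖b.repr x i‖ ^ 2) (‖x‖ ^ 2) := by
  have := lp.hasSum_norm (p := 2) (by norm_num) (b.repr x)
  simpa [b.repr.norm_map] using this

/-- The boundary input coefficients are square summable relative to the spectral gaps. -/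
theorem IsEigenSequence.summable_sq_input (hρ : ρ ≠ 0) (ha : ContinuousOn a (Set.Icc 0 1))
    (hφ : IsEigenSequence ρ a q₀ q₁ lam φ) {n : ℕ} {α : ℝ} (hα : ∀ i, n ≤ i → lam i < α)
    (u : Fin 2 → ℝ) :
    Summable fun i => if i < n then 0 else
      (ρ * (u 1 * φ i 1 - u 0 * φ i 0) / (α - lam i)) ^ 2 := by
  obtain ⟨b, hb⟩ := hφ.exists_hilbertBasis ℝ hρ ha
  obtain ⟨g, f, L⟩ := exists_robin_lift ρ a q₀ q₁ u
  have hfm := L.memLp_right ha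
  set v : StateSpace ℝ := L.memLp.toLp
  set w : StateSpace ℝ := hfm.toLp
  have e : ∀ i, b.repr w i = lam i * b.repr v i + ρ * (u 1 * φ i 1 - u 0 * φ i 0) := by
    intro i
    have := (L.congr_right hfm.coeFn_toLp.symm).eigenfunctional_eq ha (hφ.eigen i)
      L.memLp.coeFn_toLp
    rw [hb, hb]
    exact this
  have s1 := (b.hasSum_norm_sq_repr v).summable.mul_left 2
  have s2 := (b.hasSum_norm_sq_repr (w - α • v)).summable.mul_left (2 / (α - lam n) ^ 2)
  refine Summable.of_nonneg_of_le (fun i => ?_) (fun i => ?_) (s1.add s2)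
  · split_ifs
    · exact le_rfl
    · positivity
  · split_ifs with hi
    · positivity
    · push Not at hi
      have hδ : 0 < α - lam i := sub_pos.2 (hα i hi)
      have hδn : 0 < α - lam n := sub_pos.2 (hα n le_rfl)
      have hle : α - lam n ≤ α - lam i := by
        have := hφ.strictAnti.antitone hi
        linarith
      -- With w the image of the lift v, `e` reads w_i = λ_i v_i + β_i. Thus β_i / (α - λ_i) = v_i +
      -- (w - α v)_i / (α - λ_i), where the last denominator is at least α - λ_n > 0.
      have e1 : ρ * (u 1 * φ i 1 - u 0 * φ i 0) / (α - lam i) =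
          b.repr v i + b.repr (w - α • v) i / (α - lam i) := by
        simp only [map_sub, map_smul, lp.coeFn_sub, lp.coeFn_smul, Pi.sub_apply, Pi.smul_apply,
          smul_eq_mul]
        field_simp
        rw [e i]; ring
      have e2 : (b.repr (w - α • v) i / (α - lam i)) ^ 2 ≤
          b.repr (w - α • v) i ^ 2 / (α - lam n) ^ 2 := by
        rw [div_pow]
        gcongr
      rw [e1, Real.norm_eq_abs, Real.norm_eq_abs, sq_abs, sq_abs]
      calc _ ≤ 2 * (b.repr v i ^ 2 + (b.repr (w - α • v) i / (α - lam i)) ^ 2) := add_sq_le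
        _ ≤ 2 * (b.repr v i ^ 2 + b.repr (w - α • v) i ^ 2 / (α - lam n) ^ 2) := by gcongr
        _ = _ := by ring

end Modes

/-! ### Exponential estimates for linear ordinary differential equations. -/

/-- Duhamel estimate for a scalar linear equation. -/
theorem norm_le_of_hasDerivAt_linear {p g : ℝ → ℂ} {l : ℂ} {α G : ℝ}
    (hp : ContinuousOn p (Set.Ici 0))
    (hd : ∀ t : ℝ, 0 < t → HasDerivAt p (l * p t + g t) t)
    (hg : ∀ t : ℝ, 0 < t → ‖g t‖ ≤ G * Real.exp (α * t)) (hG : 0 ≤ G) (hl : l.re < α)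
    {t : ℝ} (ht : 0 ≤ t) :
    ‖p t‖ ≤ Real.exp (α * t) * (Real.exp (-(α - l.re) * t) * ‖p 0‖ + G / (α - l.re)) := by
  set δ := α - l.re with hδ
  have hδ0 : 0 < δ := sub_pos.2 hl
  have hnexp : ∀ s : ℝ, ‖Complex.exp (-l * s)‖ = Real.exp (-l.re * s) := by
    intro s
    rw [Complex.norm_exp]; simp
  set f : ℝ → ℂ := fun s => Complex.exp (-l * s) * p s with hf
  have hfd : ∀ s : ℝ, 0 < s → HasDerivAt f (Complex.exp (-l * s) * g s) s := by
    intro s hs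
    have h1 : HasDerivAt (fun s : ℝ => Complex.exp (-l * s)) (Complex.exp (-l * s) * -l) s := by
      have := ((hasDerivAt_id' (s : ℂ)).const_mul (-l)).cexp.comp_ofReal
      simpa using this
    refine (h1.mul (hd s hs)).congr_deriv ?_
    ring
  have hfc : ContinuousOn f (Set.Ici 0) :=
    ContinuousOn.mul (by fun_prop) hp
  have key : ‖f t‖ ≤ ‖p 0‖ + G / δ * Real.exp (δ * t) := by
    rcases ht.eq_or_lt with rfl | ht0
    · have : 0 ≤ G / δ * Real.exp (δ * 0) := by positivity
      simpa [hf] using this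
    -- The equation holds only for positive times, so the bound is proved on [r, t] and r tends to 0
    -- by continuity.
    have hstep : ∀ r ∈ Set.Ioo 0 t, ‖f t‖ ≤ ‖f r‖ + G / δ * Real.exp (δ * t) := by
      intro r hr
      have hB : ∀ s : ℝ, HasDerivAt
          (fun s => ‖f r‖ + G / δ * (Real.exp (δ * s) - Real.exp (δ * r)))
          (G * Real.exp (δ * s)) s := by
        intro s
        have h1 := ((hasDerivAt_id' s).const_mul δ).exp
        refine (((h1.sub_const (Real.exp (δ * r))).const_mul (G / δ)).const_add
          ‖f r‖).congr_deriv ?_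
        field_simp
      have := image_norm_le_of_norm_deriv_right_le_deriv_boundary (a := r) (b := t)
        (hfc.mono fun s hs => hr.1.le.trans hs.1)
        (fun s hs => (hfd s (hr.1.trans_le hs.1)).hasDerivWithinAt) (by simp) hB
        (fun s hs => ?_) (Set.right_mem_Icc.2 hr.2.le)
      · refine this.trans ?_
        have h2 : 0 ≤ G / δ * Real.exp (δ * r) := by positivity
        linarith
      · rw [norm_mul, hnexp]
        calc _ ≤ Real.exp (-l.re * s) * (G * Real.exp (α * s)) := by
              gcongr; exact hg s (hr.1.trans_le hs.1)
          _ = G * Real.exp (δ * s) := by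
              rw [mul_left_comm, ← Real.exp_add, hδ]; ring_nf
    have hlim : Filter.Tendsto (fun r => ‖f r‖ + G / δ * Real.exp (δ * t))
        (nhdsWithin 0 (Set.Ioi 0)) (nhds (‖f 0‖ + G / δ * Real.exp (δ * t))) := by
      refine Filter.Tendsto.add_const _ (Filter.Tendsto.norm ?_)
      exact (hfc 0 Set.self_mem_Ici).mono_left (nhdsWithin_mono _ Set.Ioi_subset_Ici_self)
    have := ge_of_tendsto hlim (by
      filter_upwards [Ioo_mem_nhdsGT ht0] with r hr using hstep r hr)
    simpa [hf] using this
  have hpf : ‖p t‖ = Real.exp (l.re * t) * ‖f t‖ := by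
    rw [hf, norm_mul, hnexp, ← mul_assoc, ← Real.exp_add]; simp
  rw [hpf]
  calc _ ≤ Real.exp (l.re * t) * (‖p 0‖ + G / δ * Real.exp (δ * t)) := by gcongr
    _ = Real.exp (l.re * t) * ‖p 0‖ + (Real.exp (l.re * t) * Real.exp (δ * t)) * (G / δ) := by ring
    _ = (Real.exp (α * t) * Real.exp (-δ * t)) * ‖p 0‖ + Real.exp (α * t) * (G / δ) := by
        rw [← Real.exp_add, ← Real.exp_add, hδ]; ring_nf
    _ = _ := by ring

/-- Exponential bound for linear systems with constant coefficients, proved by testing solutions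
with left generalized eigenvectors. -/
theorem exists_bound_of_linear_system {n : ℕ} (M : Matrix (Fin n) (Fin n) ℂ) {α : ℝ}
    (hM : ∀ z ∈ spectrum ℂ M, z.re < α) :
    ∃ C : ℝ, 0 ≤ C ∧ ∀ c : Fin n → ℝ → ℂ, (∀ i, ContinuousOn (c i) (Set.Ici 0)) →
      (∀ i, ∀ t : ℝ, 0 < t → HasDerivAt (c i) (∑ j, M i j * c j t) t) →
      ∀ i, ∀ t : ℝ, 0 ≤ t → ‖c i t‖ ≤ C * (∑ j, ‖c j 0‖) * Real.exp (α * t) := by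
  -- The row vectors w whose pairing w·c decays like e^{αt}, uniformly over solutions c. It remains
  -- to show that they fill the whole space.
  let V : Submodule ℂ (Fin n → ℂ) :=
    { carrier := {w | ∃ C : ℝ, 0 ≤ C ∧ ∀ c : Fin n → ℝ → ℂ,
        (∀ i, ContinuousOn (c i) (Set.Ici 0)) →
        (∀ i, ∀ t : ℝ, 0 < t → HasDerivAt (c i) (∑ j, M i j * c j t) t) →
        ∀ t : ℝ, 0 ≤ t → ‖∑ i, w i * c i t‖ ≤ C * (∑ j, ‖c j 0‖) * Real.exp (α * t)}
      zero_mem' := ⟨0, le_rfl, fun c _ _ t _ => by simp⟩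
      add_mem' := by
        rintro v w ⟨C, hC, hv⟩ ⟨D, hD, hw⟩
        refine ⟨C + D, add_nonneg hC hD, fun c h1 h2 t ht => ?_⟩
        have : ∑ i, (v + w) i * c i t = ∑ i, v i * c i t + ∑ i, w i * c i t := by
          rw [← Finset.sum_add_distrib]
          exact Finset.sum_congr rfl fun i _ => by rw [Pi.add_apply, add_mul]
        rw [this]
        refine (norm_add_le _ _).trans ((add_le_add (hv c h1 h2 t ht) (hw c h1 h2 t ht)).trans ?_)
        exact le_of_eq (by ring)
      smul_mem' := by
        rintro r v ⟨C, hC, hv⟩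
        refine ⟨‖r‖ * C, by positivity, fun c h1 h2 t ht => ?_⟩
        have : ∑ i, (r • v) i * c i t = r * ∑ i, v i * c i t := by
          rw [Finset.mul_sum]
          exact Finset.sum_congr rfl fun i _ => by rw [Pi.smul_apply, smul_eq_mul, mul_assoc]
        rw [this, norm_mul]
        refine (mul_le_mul_of_nonneg_left (hv c h1 h2 t ht) (norm_nonneg r)).trans ?_
        exact le_of_eq (by ring) }
  have hstep : ∀ (l : ℂ) (k : ℕ) (w : Fin n → ℂ),
      ((M.vecMulLinear - algebraMap ℂ (Module.End ℂ (Fin n → ℂ)) l) ^ k) w = 0 → w ∈ V := by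
    intro l k
    induction k with
    | zero =>
      intro w hw
      rw [pow_zero] at hw
      have hw : w = 0 := hw
      rw [hw]
      exact V.zero_mem
    | succ k ih =>
      intro w hw
      by_cases hl : l ∈ spectrum ℂ M
      -- The pairing p = w·c satisfies p' = l p + w'·c, where w' is lower in the Jordan chain and so
      -- already controlled. The strict gap Re l < α avoids polynomial factors.
      · rw [pow_succ] at hw
        obtain ⟨C, hC, hCw⟩ := ih _ hw
        have hl' := hM l hl
        have hδ : 0 < α - l.re := sub_pos.2 hl'
        set w' := (M.vecMulLinear - algebraMap ℂ (Module.End ℂ (Fin n → ℂ)) l) w with hw'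
        have hww' : ∀ j, ∑ i, w i * M i j = l * w j + w' j := by
          intro j
          simp [hw', Matrix.vecMul, dotProduct, Module.algebraMap_end_apply]
        refine ⟨∑ i, ‖w i‖ + C / (α - l.re), by positivity, fun c h1 h2 t ht => ?_⟩
        set S := ∑ j, ‖c j 0‖ with hS
        have hS0 : 0 ≤ S := Finset.sum_nonneg fun j _ => norm_nonneg _
        have hbd := norm_le_of_hasDerivAt_linear (p := fun t => ∑ i, w i * c i t)
          (g := fun t => ∑ i, w' i * c i t) (l := l) (α := α) (G := C * S)
          (continuousOn_finsetSum _ fun i _ => continuousOn_const.mul (h1 i)) ?_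
          (fun t ht => hCw c h1 h2 t ht.le) (by positivity) hl' ht
        · refine hbd.trans ?_
          have e1 : ‖∑ i, w i * c i 0‖ ≤ (∑ i, ‖w i‖) * S := by
            refine (norm_sum_le _ _).trans ?_
            rw [Finset.sum_mul]
            refine Finset.sum_le_sum fun i _ => ?_
            rw [norm_mul]
            gcongr
            exact Finset.single_le_sum (f := fun j => ‖c j 0‖) (fun j _ => norm_nonneg _)
              (Finset.mem_univ i)
          have e2 : Real.exp (-(α - l.re) * t) ≤ 1 :=
            Real.exp_le_one_iff.2 (by nlinarith)
          calc _ ≤ Real.exp (α * t) * (1 * ((∑ i, ‖w i‖) * S) + C * S / (α - l.re)) := by gcongr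
            _ = _ := by ring
        · intro s hs
          have h3 := HasDerivAt.fun_sum (u := Finset.univ)
            fun i _ => (h2 i s hs).const_mul (w i)
          refine h3.congr_deriv ?_
          have : ∑ i, w i * ∑ j, M i j * c j s = ∑ j, (∑ i, w i * M i j) * c j s := by
            simp_rw [Finset.mul_sum, Finset.sum_mul]
            rw [Finset.sum_comm]
            exact Finset.sum_congr rfl fun j _ => Finset.sum_congr rfl fun i _ => by ring
          rw [this, Finset.mul_sum, ← Finset.sum_add_distrib]
          exact Finset.sum_congr rfl fun j _ => by rw [hww' j]; ring
      -- Off the spectrum the factor is injective and can be cancelled, so the exponent drops by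
      -- one.
      · refine ih w ?_
        rw [pow_succ'] at hw
        set w' := ((M.vecMulLinear - algebraMap ℂ (Module.End ℂ (Fin n → ℂ)) l) ^ k) w
        have hw : (M.vecMulLinear - algebraMap ℂ (Module.End ℂ (Fin n → ℂ)) l) w' = 0 := hw
        rw [spectrum.notMem_iff] at hl
        refine Matrix.vecMul_injective_of_isUnit hl ?_
        have h4 : Matrix.vecMul w' (algebraMap ℂ (Matrix (Fin n) (Fin n) ℂ) l) = l • w' := by
          rw [Algebra.algebraMap_eq_smul_one, Matrix.vecMul_smul, Matrix.vecMul_one]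
        simp only [LinearMap.sub_apply, Matrix.vecMulLinear_apply,
          Module.algebraMap_end_apply] at hw
        simp only [Matrix.zero_vecMul, Matrix.vecMul_sub, h4]
        rw [← neg_sub, hw, neg_zero, sub_zero]
  have htop : V = ⊤ := by
    rw [eq_top_iff, ← Module.End.iSup_maxGenEigenspace_eq_top (M.vecMulLinear)]
    refine iSup_le fun l w hw => ?_
    obtain ⟨k, hk⟩ := (Module.End.mem_maxGenEigenspace _ _ _).1 hw
    exact hstep l k w (by rwa [Algebra.algebraMap_eq_smul_one])
  have hV : ∀ i : Fin n, Pi.single i (1 : ℂ) ∈ V := fun i => htop ▸ Submodule.mem_top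
  choose C hC hCb using hV
  refine ⟨∑ i, C i, Finset.sum_nonneg fun i _ => hC i, fun c h1 h2 i t ht => ?_⟩
  have := hCb i c h1 h2 t ht
  rw [Finset.sum_eq_single i (fun j _ hj => by rw [Pi.single_eq_of_ne hj, zero_mul])
    (fun h => absurd (Finset.mem_univ i) h), Pi.single_eq_same, one_mul] at this
  refine this.trans ?_
  gcongr
  exact Finset.single_le_sum (fun j _ => hC j) (Finset.mem_univ i)

/-- Allows estimates proved over ℂ to serve both scalar fields. -/
theorem RCLike.norm_map_complex {𝕜 : Type*} [RCLike 𝕜] (x : 𝕜) : ‖RCLike.map 𝕜 ℂ x‖ = ‖x‖ := by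
  rw [← sq_eq_sq₀ (norm_nonneg _) (norm_nonneg _), RCLike.norm_sq_eq_def, RCLike.norm_sq_eq_def]
  simp

theorem RCLike.map_complex_ofReal_mul {𝕜 : Type*} [RCLike 𝕜] (r : ℝ) (x : 𝕜) :
    RCLike.map 𝕜 ℂ ((r : 𝕜) * x) = (r : ℂ) * RCLike.map 𝕜 ℂ x := by
  rw [← RCLike.real_smul_eq_coe_mul, map_smul, Complex.real_smul]

/-! ### The modal equations: bounds and solutions. -/

section Modal

variable {𝕜 : Type*} [RCLike 𝕜] {n : ℕ}

/-- The family of scalar equations for the modes of the closed loop, in which only the first `n`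
modes are fed back. -/
def IsModalSolution (lam : ℕ → ℝ) (κ : ℕ → Fin n → ℝ) (c : ℕ → ℝ → 𝕜) : Prop :=
  ∀ i, ContinuousOn (c i) (Set.Ici 0) ∧ ∀ t : ℝ, 0 < t →
    HasDerivAt (c i) ((lam i : 𝕜) * c i t - ∑ j : Fin n, (κ i j : 𝕜) * c j t) t

variable {lam : ℕ → ℝ} {κ : ℕ → Fin n → ℝ} {c : ℕ → ℝ → 𝕜}

theorem IsModalSolution.map_complex (hc : IsModalSolution lam κ c) :
    IsModalSolution lam κ fun i t => RCLike.map 𝕜 ℂ (c i t) := by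
  intro i
  refine ⟨(RCLike.map 𝕜 ℂ).continuous.comp_continuousOn (hc i).1, fun t ht => ?_⟩
  have := (RCLike.map 𝕜 ℂ).hasFDerivAt.comp_hasDerivAt t ((hc i).2 t ht)
  refine this.congr_deriv ?_
  simp only [map_sub, map_sum, RCLike.map_complex_ofReal_mul]
  rfl

/-- The low modes decay by the matrix estimate, and Duhamel's estimate carries this to the others.
The factor e^{-(α-λ_i)t} on the initial value is kept because smoothing depends on it. -/
theorem exists_modal_bound {α : ℝ}
    (hM : ∀ z ∈ spectrum ℂ ((modalMatrix n lam - Matrix.of fun i j : Fin n => κ i j).map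
      (algebraMap ℝ ℂ)), z.re < α) (hα : ∀ i, n ≤ i → lam i < α) :
    ∃ C : ℝ, 0 ≤ C ∧ ∀ c : ℕ → ℝ → 𝕜, IsModalSolution lam κ c → ∀ t : ℝ, 0 ≤ t →
      (∀ i < n, ‖c i t‖ ≤ Real.exp (α * t) * (C * ∑ j : Fin n, ‖c j 0‖)) ∧
      (∀ i, n ≤ i → ‖c i t‖ ≤ Real.exp (α * t) * (Real.exp (-(α - lam i) * t) * ‖c i 0‖ +
        C * ((∑ j, |κ i j|) / (α - lam i)) * ∑ j : Fin n, ‖c j 0‖)) := by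
  obtain ⟨C, hC, hCb⟩ := exists_bound_of_linear_system _ hM
  refine ⟨C, hC, fun c hc t ht => ?_⟩
  have hc' := hc.map_complex
  have hlow : ∀ i : Fin n, ∀ t : ℝ, 0 ≤ t →
      ‖c i t‖ ≤ C * (∑ j : Fin n, ‖c j 0‖) * Real.exp (α * t) := by
    intro i t ht
    have := hCb (fun i t => RCLike.map 𝕜 ℂ (c i t)) (fun i => (hc' i).1) (fun i t ht => ?_) i t ht
    · simpa only [RCLike.norm_map_complex] using this
    · refine ((hc' i).2 t ht).congr_deriv ?_
      simp [modalMatrix, Matrix.diagonal_apply, sub_mul, Finset.sum_sub_distrib, ite_mul,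
        apply_ite (Complex.ofReal)]
  refine ⟨fun i hi => (hlow ⟨i, hi⟩ t ht).trans (le_of_eq (by ring)), fun i hi => ?_⟩
  set S := ∑ j : Fin n, ‖c j 0‖ with hS
  have hS0 : 0 ≤ S := Finset.sum_nonneg fun j _ => norm_nonneg _
  have := norm_le_of_hasDerivAt_linear (p := fun t => RCLike.map 𝕜 ℂ (c i t))
    (g := fun t => -∑ j : Fin n, (κ i j : ℂ) * RCLike.map 𝕜 ℂ (c j t)) (l := (lam i : ℂ)) (α := α)
    (G := C * (∑ j, |κ i j|) * S) (hc' i).1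
    (fun t ht => ((hc' i).2 t ht).congr_deriv (sub_eq_add_neg _ _)) (fun t ht => ?_)
    (by positivity) (by simpa using hα i hi) ht
  · simp only [RCLike.norm_map_complex, Complex.ofReal_re] at this
    refine this.trans (le_of_eq ?_)
    ring
  · rw [norm_neg]
    refine (norm_sum_le _ _).trans ?_
    calc _ ≤ ∑ j : Fin n, |κ i j| * (C * S * Real.exp (α * t)) := by
          refine Finset.sum_le_sum fun j _ => ?_
          rw [norm_mul, RCLike.norm_map_complex, Complex.norm_real, Real.norm_eq_abs]
          exact mul_le_mul_of_nonneg_left (hlow j t ht.le) (abs_nonneg _)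
      _ = _ := by rw [← Finset.sum_mul]; ring

/-- Existence of modal solutions which are differentiable, with derivatives solving the same
equations. -/
theorem exists_modal_solution (lam : ℕ → ℝ) (κ : ℕ → Fin n → ℝ) (c₀ : ℕ → 𝕜) :
    ∃ c e : ℕ → ℝ → 𝕜, IsModalSolution lam κ c ∧ IsModalSolution lam κ e ∧
      (∀ i, c i 0 = c₀ i) ∧ (∀ i t, HasDerivAt (c i) (e i t) t) ∧
      ∀ i t, e i t = (lam i : 𝕜) * c i t - ∑ j : Fin n, (κ i j : 𝕜) * c j t := by
  let A₀ : (Fin n → 𝕜) →ₗ[ℝ] (Fin n → 𝕜) :=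
    { toFun := fun d i => (lam i : 𝕜) * d i - ∑ j, (κ i j : 𝕜) * d j
      map_add' := fun d e => by
        ext i
        simp only [Pi.add_apply, mul_add, Finset.sum_add_distrib]; ring
      map_smul' := fun r d => by
        ext i
        simp only [Pi.smul_apply, RCLike.real_smul_eq_coe_mul, RingHom.id_apply, mul_sub,
          Finset.mul_sum]
        refine congrArg₂ _ (by ring) (Finset.sum_congr rfl fun j _ => by ring) }
  let A : (Fin n → 𝕜) →L[ℝ] (Fin n → 𝕜) := LinearMap.toContinuousLinearMap A₀
  let d : ℝ → Fin n → 𝕜 := fun t => NormedSpace.exp (t • A) fun j => c₀ j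
  have hd : ∀ t, HasDerivAt d (A (d t)) t := by
    intro t
    have h1 := hasDerivAt_exp_smul_const' A t
    have h2 := h1.clm_apply (hasDerivAt_const t fun j : Fin n => c₀ j)
    refine h2.congr_deriv ?_
    simp [d]
  have hdi : ∀ (i : Fin n) t,
      HasDerivAt (fun t => d t i) ((lam i : 𝕜) * d t i - ∑ j, (κ i j : 𝕜) * d t j) t :=
    fun i t => hasDerivAt_pi.1 (hd t) i
  have hdc : Continuous d := continuous_iff_continuousAt.2 fun t => (hd t).continuousAt
  have hexp0 : NormedSpace.exp ((0 : ℝ) • A) = 1 := 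
    (congrArg NormedSpace.exp (zero_smul ℝ A)).trans NormedSpace.exp_zero
  have hex : ∀ i, ∃ c : ℝ → 𝕜, c 0 = c₀ i ∧
      (∀ t, HasDerivAt c ((lam i : 𝕜) * c t - ∑ j, (κ i j : 𝕜) * d t j) t) ∧
      ∀ hi : i < n, c = fun t => d t ⟨i, hi⟩ := by
    intro i
    by_cases hi : i < n
    · exact ⟨fun t => d t ⟨i, hi⟩, congrFun (congrArg (fun B : (Fin n → 𝕜) →L[ℝ] (Fin n → 𝕜) =>
        B fun j => c₀ j) hexp0) ⟨i, hi⟩, hdi ⟨i, hi⟩, fun _ => rfl⟩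
    -- The higher modes are driven by the known low modes `d`, so variation of constants solves
    -- them.
    · set g : ℝ → 𝕜 := fun s => Real.exp (-lam i * s) • -∑ j, (κ i j : 𝕜) * d s j with hg
      have hgc : Continuous g := by
        have : ∀ j, Continuous fun s => d s j := fun j => (continuous_apply j).comp hdc
        fun_prop
      refine ⟨fun t => Real.exp (lam i * t) • (c₀ i + ∫ s in (0 : ℝ)..t, g s), by simp,
        fun t => ?_, fun h => absurd h hi⟩
      have h1 := ((hasDerivAt_id' t).const_mul (lam i)).exp
      have h2 := (intervalIntegral.integral_hasDerivAt_right (hgc.intervalIntegrable 0 t)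
        (hgc.stronglyMeasurableAtFilter _ _) hgc.continuousAt).const_add (c₀ i)
      refine (h1.smul h2).congr_deriv ?_
      have h3 : Real.exp (lam i * t) • g t = -∑ j, (κ i j : 𝕜) * d t j := by
        rw [hg, smul_smul, ← Real.exp_add]; simp
      rw [h3]
      simp only [RCLike.real_smul_eq_coe_mul]
      push_cast
      ring
  choose c hc0 hcd hcn using hex
  have hcd' : ∀ i t,
      HasDerivAt (c i) ((lam i : 𝕜) * c i t - ∑ j : Fin n, (κ i j : 𝕜) * c j t) t := by
    intro i t
    refine (hcd i t).congr_deriv ?_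
    congr 1
    exact Finset.sum_congr rfl fun j _ => by rw [hcn j j.2]
  refine ⟨c, fun i t => (lam i : 𝕜) * c i t - ∑ j : Fin n, (κ i j : 𝕜) * c j t, fun i =>
    ⟨fun t _ => (hcd' i t).continuousAt.continuousWithinAt, fun t _ => hcd' i t⟩, fun i => ?_,
    hc0, hcd', fun _ _ => rfl⟩
  have hed : ∀ t, HasDerivAt
      (fun t => (lam i : 𝕜) * c i t - ∑ j : Fin n, (κ i j : 𝕜) * c j t) _ t :=
    fun t => ((hcd' i t).const_mul (lam i : 𝕜)).sub
      (HasDerivAt.fun_sum fun j _ => (hcd' j t).const_mul (κ i j : 𝕜))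
  exact ⟨fun t _ => (hed t).continuousAt.continuousWithinAt, fun t _ => hed t⟩

end Modal

/-! ### Limits and derivatives through coordinates in a Hilbert basis. -/

section HilbertBasisLimits

variable {𝕜 : Type*} [RCLike 𝕜] {ι H : Type*} [NormedAddCommGroup H] [InnerProductSpace 𝕜 H]

theorem Summable.add_sq {m m' : ι → ℝ} (hm : Summable fun i => m i ^ 2)
    (hm' : Summable fun i => m' i ^ 2) : Summable fun i => (m i + m' i) ^ 2 := by
  refine Summable.of_nonneg_of_le (fun i => sq_nonneg _) (fun i => ?_)
    ((hm.mul_left 2).add (hm'.mul_left 2))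
  exact add_sq_le.trans (le_of_eq (by ring))

theorem Summable.const_mul_sq {m : ι → ℝ} (hm : Summable fun i => m i ^ 2) (r : ℝ) :
    Summable fun i => (r * m i) ^ 2 := by
  simp_rw [mul_pow]
  exact hm.mul_left _

/-- Coordinatewise convergence with a square summable bound implies convergence. -/
theorem HilbertBasis.tendsto_of_dominated {β : Type*} {l : Filter β} (b : HilbertBasis ι 𝕜 H)
    {x : β → H} {x₀ : H} {m : ι → ℝ} (hm : Summable fun i => m i ^ 2)
    (hb : ∀ᶠ s in l, ∀ i, ‖b.repr (x s) i‖ ≤ m i)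
    (hl : ∀ i, Filter.Tendsto (fun s => b.repr (x s) i) l (nhds (b.repr x₀ i))) :
    Filter.Tendsto x l (nhds x₀) := by
  rw [tendsto_iff_norm_sub_tendsto_zero]
  have hsq : Filter.Tendsto (fun s => ‖x s - x₀‖ ^ 2) l (nhds 0) := by
    -- Dominated convergence for the Parseval series of the difference.
    have h := tendsto_tsum_of_dominated_convergence (𝓕 := l)
      (f := fun s i => ‖b.repr (x s - x₀) i‖ ^ 2) (g := fun _ => (0 : ℝ))
      (bound := fun i => (m i + ‖b.repr x₀ i‖) ^ 2)
      (hm.add_sq (b.hasSum_norm_sq_repr x₀).summable) ?_ ?_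
    · rw [tsum_zero] at h
      refine h.congr fun s => ?_
      exact (b.hasSum_norm_sq_repr (x s - x₀)).tsum_eq
    · intro i
      have h1 : Filter.Tendsto (fun s => ‖b.repr (x s - x₀) i‖) l (nhds 0) := by
        have := tendsto_iff_norm_sub_tendsto_zero.1 (hl i)
        refine this.congr fun s => ?_
        rw [map_sub, lp.coeFn_sub, Pi.sub_apply]
      simpa using h1.pow 2
    · filter_upwards [hb] with s hs i
      rw [norm_pow, norm_norm]
      refine pow_le_pow_left₀ (norm_nonneg _) ?_ 2
      rw [map_sub, lp.coeFn_sub, Pi.sub_apply]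
      exact (norm_sub_le _ _).trans (add_le_add_left (hs i) _)
  have := hsq.sqrt
  simpa [Real.sqrt_sq (norm_nonneg _)] using this

theorem HilbertBasis.exists_repr_eq (b : HilbertBasis ι 𝕜 H) {c : ι → 𝕜} {m : ι → ℝ}
    (hm : Summable fun i => m i ^ 2) (hc : ∀ i, ‖c i‖ ≤ m i) : ∃ x, ∀ i, b.repr x i = c i := by
  have hmem : Memℓp c 2 := by
    refine memℓp_gen ?_
    simp only [ENNReal.toReal_ofNat, Real.rpow_two]
    exact Summable.of_nonneg_of_le (fun i => sq_nonneg _)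
      (fun i => pow_le_pow_left₀ (norm_nonneg _) (hc i) 2) hm
  exact ⟨b.repr.symm ⟨c, hmem⟩, fun i => by rw [LinearIsometryEquiv.apply_symm_apply]⟩

/-- Coordinatewise differentiability with a square summable bound implies differentiability. -/
theorem HilbertBasis.hasDerivAt_of_dominated [NormedSpace ℝ H] [IsScalarTower ℝ 𝕜 H]
    (b : HilbertBasis ι 𝕜 H) {x : ℝ → H} {y : H} {c e : ι → ℝ → 𝕜} {m : ι → ℝ} {t r : ℝ}
    (hm : Summable fun i => m i ^ 2) (hr : 0 < r)
    (hx : ∀ s ∈ Metric.ball t r, ∀ i, b.repr (x s) i = c i s)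
    (hd : ∀ i, ∀ s ∈ Metric.ball t r, HasDerivAt (c i) (e i s) s)
    (hbd : ∀ s ∈ Metric.ball t r, ∀ i, ‖e i s‖ ≤ m i) (hy : ∀ i, b.repr y i = e i t) :
    HasDerivAt x y t := by
  have ht : t ∈ Metric.ball t r := Metric.mem_ball_self hr
  have hnear : ∀ᶠ s in nhdsWithin t {t}ᶜ, s ∈ Metric.ball t r :=
    nhdsWithin_le_nhds (Metric.ball_mem_nhds t hr)
  have hslope : ∀ s ∈ Metric.ball t r, ∀ i, b.repr (slope x t s) i = slope (c i) t s := by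
    intro s hs i
    rw [slope_def_module, slope_def_module, RCLike.real_smul_eq_coe_smul (K := 𝕜), map_smul,
      map_sub, lp.coeFn_smul, lp.coeFn_sub, Pi.smul_apply, Pi.sub_apply, hx s hs, hx t ht,
      RCLike.real_smul_eq_coe_smul (K := 𝕜)]
  rw [hasDerivAt_iff_tendsto_slope]
  refine b.tendsto_of_dominated hm ?_ fun i => ?_
  -- By the mean value inequality the bound on the derivative of a coordinate also bounds its
  -- difference quotients.
  · filter_upwards [hnear, self_mem_nhdsWithin] with s hs hne i
    rw [hslope s hs i, slope_def_module, norm_smul, norm_inv]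
    have hne' : 0 < ‖s - t‖ := norm_pos_iff.2 (sub_ne_zero.2 hne)
    rw [inv_mul_le_iff₀ hne', mul_comm]
    exact (convex_ball t r).norm_image_sub_le_of_norm_hasDerivWithin_le
      (fun s hs => (hd i s hs).hasDerivWithinAt) (fun s hs => hbd s hs i) ht hs
  · rw [hy i]
    refine (hasDerivAt_iff_tendsto_slope.1 (hd i t ht)).congr' ?_
    filter_upwards [hnear] with s hs using (hslope s hs i).symm

end HilbertBasisLimits

/-! ### Spillover and smoothing estimates for the closed loop. -/

section ClosedLoop

variable {𝕜 : Type*} [RCLike 𝕜] {ρ : ℝ} {a : ℝ → ℝ} {q₀ q₁ : ℝ} {lam : ℕ → ℝ}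
  {φ : ℕ → ℝ → ℝ} {n : ℕ}

/-- The influence of mode `j` on mode `i` through the feedback. -/
def feedbackGain (ρ : ℝ) (φ : ℕ → ℝ → ℝ) (K : Matrix (Fin 2) (Fin n) ℝ) (i : ℕ) (j : Fin n) : ℝ :=
  ρ * (K 1 j * φ i 1 - K 0 j * φ i 0)

theorem modalMatrix_sub_inputMatrix_mul (K : Matrix (Fin 2) (Fin n) ℝ) :
    modalMatrix n lam - inputMatrix n ρ φ * K =
      modalMatrix n lam - Matrix.of fun i j : Fin n => feedbackGain ρ φ K i j := by
  congr 1
  ext i j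
  simp [inputMatrix, Matrix.mul_apply, Fin.sum_univ_two, feedbackGain]
  ring

theorem input_feedback_eq (K : Matrix (Fin 2) (Fin n) ℝ) (x : StateSpace 𝕜) (i : ℕ) :
    (ρ : 𝕜) * (feedback K φ x 1 * (φ i 1 : 𝕜) - feedback K φ x 0 * (φ i 0 : 𝕜)) =
      -∑ j : Fin n, (feedbackGain ρ φ K i j : 𝕜) * eigenfunctional (φ j) x := by
  simp only [feedback, feedbackGain]
  push_cast
  rw [neg_mul, neg_mul, sub_neg_eq_add, mul_add, mul_neg, Finset.sum_mul, Finset.sum_mul,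
    Finset.mul_sum, Finset.mul_sum, ← sub_eq_neg_add, ← Finset.sum_sub_distrib,
    ← Finset.sum_neg_distrib]
  exact Finset.sum_congr rfl fun j _ => by ring

theorem IsClosedLoopSolution.isModalSolution (ha : ContinuousOn a (Set.Icc 0 1))
    (hφ : IsEigenSequence ρ a q₀ q₁ lam φ) {K : Matrix (Fin 2) (Fin n) ℝ}
    {x : ℝ → StateSpace 𝕜} (hx : IsClosedLoopSolution ρ a q₀ q₁ K φ x) :
    IsModalSolution lam (feedbackGain ρ φ K) fun i t => eigenfunctional (φ i) (x t) := by
  intro i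
  have hinner : ∀ v : StateSpace 𝕜,
      (innerSL 𝕜 ((hφ.eigen i).toState 𝕜)).restrictScalars ℝ v = eigenfunctional (φ i) v :=
    fun v => (hφ.eigen i).inner_toState v
  have hfun : (fun t => eigenfunctional (φ i) (x t)) =
      (innerSL 𝕜 ((hφ.eigen i).toState 𝕜)).restrictScalars ℝ ∘ x :=
    funext fun t => (hinner (x t)).symm
  simp only [hfun]
  refine ⟨((innerSL 𝕜 ((hφ.eigen i).toState 𝕜)).restrictScalars ℝ).continuous.comp_continuousOn
    hx.continuousOn, fun t ht => ?_⟩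
  obtain ⟨h, y, hd, hxh, H⟩ := hx.dynamics t ht
  refine (((innerSL 𝕜 ((hφ.eigen i).toState 𝕜)).restrictScalars
    ℝ).hasFDerivAt.comp_hasDerivAt t hd).congr_deriv ?_
  rw [hinner, H.eigenfunctional_eq ha (hφ.eigen i) hxh, input_feedback_eq,
    ← sub_eq_add_neg]

/-- Coefficients controlling the modes driven by the feedback. -/
def spilloverWeight (lam : ℕ → ℝ) (κ : ℕ → Fin n → ℝ) (α : ℝ) (i : ℕ) : ℝ :=
  if i < n then 1 else (∑ j, |κ i j|) / (α - lam i)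

theorem spilloverWeight_nonneg {κ : ℕ → Fin n → ℝ} {α : ℝ} (hα : ∀ i, n ≤ i → lam i < α) (i : ℕ) :
    0 ≤ spilloverWeight lam κ α i := by
  unfold spilloverWeight
  split_ifs with hi
  · exact zero_le_one
  · have := sub_pos.2 (hα i (not_lt.1 hi))
    positivity

/-- For fixed j the gains are the boundary coefficients of the datum given by column j of K.
Cauchy–Schwarz over the n columns costs a factor n. -/
theorem summable_sq_spilloverWeight (hρ : ρ ≠ 0) (ha : ContinuousOn a (Set.Icc 0 1))
    (hφ : IsEigenSequence ρ a q₀ q₁ lam φ) (K : Matrix (Fin 2) (Fin n) ℝ) {α : ℝ}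
    (hα : ∀ i, n ≤ i → lam i < α) :
    Summable fun i => spilloverWeight lam (feedbackGain ρ φ K) α i ^ 2 := by
  have s1 : Summable fun i : ℕ => if i < n then (1 : ℝ) else 0 :=
    summable_of_ne_finset_zero (s := Finset.range n) fun i hi => by
      rw [Finset.mem_range] at hi
      exact if_neg hi
  have s2 : Summable fun i => ∑ j : Fin n, if i < n then 0 else
      (feedbackGain ρ φ K i j / (α - lam i)) ^ 2 :=
    summable_sum fun j _ => hφ.summable_sq_input hρ ha hα fun k => K k j
  refine Summable.of_nonneg_of_le (fun i => sq_nonneg _) (fun i => ?_)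
    (s1.add (s2.mul_left (n : ℝ)))
  unfold spilloverWeight
  split_ifs with hi
  · simp
  · rw [Finset.sum_div, zero_add]
    refine (sq_sum_le_card_mul_sum_sq).trans ?_
    simp [div_pow]

/-- Discards the extra decay of the initial value, leaving a bound of one form for low and high
modes whose bracket is square summable in i when the initial modes and the weights are. -/
theorem norm_modal_le {α C : ℝ} {κ : ℕ → Fin n → ℝ} (hα : ∀ i, n ≤ i → lam i < α) {c : ℕ → ℝ → 𝕜}
    {t : ℝ} (ht : 0 ≤ t)
    (hC : (∀ i < n, ‖c i t‖ ≤ Real.exp (α * t) * (C * ∑ j : Fin n, ‖c j 0‖)) ∧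
      (∀ i, n ≤ i → ‖c i t‖ ≤ Real.exp (α * t) * (Real.exp (-(α - lam i) * t) * ‖c i 0‖ +
        C * ((∑ j, |κ i j|) / (α - lam i)) * ∑ j : Fin n, ‖c j 0‖))) (i : ℕ) :
    ‖c i t‖ ≤ Real.exp (α * t) *
      (‖c i 0‖ + C * (∑ j : Fin n, ‖c j 0‖) * spilloverWeight lam κ α i) := by
  unfold spilloverWeight
  split_ifs with hi
  · refine (hC.1 i hi).trans ?_
    rw [mul_one]
    gcongr
    exact le_add_of_nonneg_left (norm_nonneg _)
  · push Not at hi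
    refine (hC.2 i hi).trans ?_
    have h1 : Real.exp (-(α - lam i) * t) ≤ 1 :=
      Real.exp_le_one_iff.2 (by nlinarith [hα i hi])
    calc _ ≤ Real.exp (α * t) * (1 * ‖c i 0‖ +
        C * ((∑ j, |κ i j|) / (α - lam i)) * ∑ j : Fin n, ‖c j 0‖) := by gcongr
      _ = _ := by ring

/-- Parabolic smoothing in scalar form: the growth of the eigenvalues is traded for a factor 1/τ. -/
theorem mul_exp_neg_mul_le {δ τ : ℝ} (hτ : 0 < τ) : δ * Real.exp (-δ * τ) ≤ 1 / τ := by
  rw [le_div_iff₀ hτ]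
  have h1 := Real.add_one_le_exp (δ * τ)
  have h2 : Real.exp (-δ * τ) * Real.exp (δ * τ) = 1 := by rw [← Real.exp_add]; simp
  have h3 := Real.exp_pos (-δ * τ)
  nlinarith

/-- Smoothing: the derivatives of the modes are bounded by a square summable sequence at positive
times. -/
theorem norm_modal_deriv_le {α C τ t : ℝ} {κ : ℕ → Fin n → ℝ} (hα : ∀ i, n ≤ i → lam i < α)
    (hα0 : α < 0) (hC0 : 0 ≤ C) (hτ : 0 < τ) (ht : τ ≤ t) {c e : ℕ → ℝ → 𝕜}
    (he : ∀ i t, e i t = (lam i : 𝕜) * c i t - ∑ j : Fin n, (κ i j : 𝕜) * c j t)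
    (hC : (∀ i < n, ‖e i t‖ ≤ Real.exp (α * t) * (C * ∑ j : Fin n, ‖e j 0‖)) ∧
      (∀ i, n ≤ i → ‖e i t‖ ≤ Real.exp (α * t) * (Real.exp (-(α - lam i) * t) * ‖e i 0‖ +
        C * ((∑ j, |κ i j|) / (α - lam i)) * ∑ j : Fin n, ‖e j 0‖))) (i : ℕ) :
    ‖e i t‖ ≤ (1 / τ + |α|) * ‖c i 0‖ +
      (1 / τ * (∑ j : Fin n, ‖c j 0‖) + C * (∑ j : Fin n, ‖e j 0‖)) *
        spilloverWeight lam κ α i := by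
  have hexp : Real.exp (α * t) ≤ 1 :=
    Real.exp_le_one_iff.2 (mul_nonpos_of_nonpos_of_nonneg hα0.le (hτ.le.trans ht))
  set S := ∑ j : Fin n, ‖c j 0‖ with hS
  set S' := ∑ j : Fin n, ‖e j 0‖ with hS'
  have hS0 : 0 ≤ S := Finset.sum_nonneg fun j _ => norm_nonneg _
  have hS0' : 0 ≤ S' := Finset.sum_nonneg fun j _ => norm_nonneg _
  unfold spilloverWeight
  split_ifs with hi
  · refine (hC.1 i hi).trans ((mul_le_of_le_one_left (by positivity) hexp).trans ?_)
    have h1 : 0 ≤ (1 / τ + |α|) * ‖c i 0‖ := by positivity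
    have h2 : 0 ≤ 1 / τ * S := by positivity
    linarith
  · push Not at hi
    have hδ : 0 < α - lam i := sub_pos.2 (hα i hi)
    set δ := α - lam i with hδdef
    set k := ∑ j, |κ i j| with hk
    have hk0 : 0 ≤ k := Finset.sum_nonneg fun j _ => abs_nonneg _
    -- The initial derivative grows with δ, since λ_i = α - δ; the factor e^{-δt} compensates below.
    have he0 : ‖e i 0‖ ≤ (δ + |α|) * ‖c i 0‖ + k * S := by
      rw [he i 0]
      refine (norm_sub_le _ _).trans (add_le_add ?_ ?_)
      · rw [norm_mul, RCLike.norm_ofReal]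
        gcongr
        rw [show lam i = -(δ) + α by rw [hδdef]; ring]
        refine (abs_add_le _ _).trans ?_
        rw [abs_neg, abs_of_pos hδ]
      · refine (norm_sum_le _ _).trans ?_
        rw [hk, Finset.sum_mul]
        refine Finset.sum_le_sum fun j _ => ?_
        rw [norm_mul, RCLike.norm_ofReal]
        gcongr
        exact Finset.single_le_sum (f := fun j : Fin n => ‖c j 0‖) (fun j _ => norm_nonneg _)
          (Finset.mem_univ j)
    have hd1 : Real.exp (-δ * t) ≤ 1 := Real.exp_le_one_iff.2 (by nlinarith)
    have hd2 : δ * Real.exp (-δ * t) ≤ 1 / τ := by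
      refine le_trans ?_ (mul_exp_neg_mul_le (δ := δ) hτ)
      gcongr ?_ * Real.exp ?_
      nlinarith
    have hd3 : Real.exp (-δ * t) ≤ 1 / τ / δ := by
      rw [le_div_iff₀ hδ, mul_comm]; exact hd2
    have hmain : Real.exp (-δ * t) * ‖e i 0‖ ≤ (1 / τ + |α|) * ‖c i 0‖ + 1 / τ / δ * (k * S) := by
      calc _ ≤ Real.exp (-δ * t) * ((δ + |α|) * ‖c i 0‖ + k * S) := by gcongr
        _ = (δ * Real.exp (-δ * t) + Real.exp (-δ * t) * |α|) * ‖c i 0‖ +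
            Real.exp (-δ * t) * (k * S) := by ring
        _ ≤ (1 / τ + 1 * |α|) * ‖c i 0‖ + 1 / τ / δ * (k * S) := by gcongr
        _ = _ := by ring
    refine (hC.2 i hi).trans ((mul_le_of_le_one_left (by positivity) hexp).trans ?_)
    refine (add_le_add_left hmain _).trans (le_of_eq ?_)
    ring

end ClosedLoop

end

theorem theorem1 {𝕜 : Type*} [RCLike 𝕜]
    (ρ : ℝ) (hρ : 0 < ρ) (a : ℝ → ℝ) (ha : ContinuousOn a (Set.Icc 0 1)) (q₀ q₁ : ℝ)
    (lam : ℕ → ℝ) (φ : ℕ → ℝ → ℝ) (hφ : IsEigenSequence ρ a q₀ q₁ lam φ)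
    (n : ℕ) (K : Matrix (Fin 2) (Fin n) ℝ)
    (lmax : ℝ)
    (hmax : IsGreatest (Complex.re '' spectrum ℂ
      ((modalMatrix n lam - inputMatrix n ρ φ * K).map (algebraMap ℝ ℂ))) lmax)
    (hHurwitz : lmax < 0)
    (ε : ℝ) (hε : 0 < ε) (hα_modes : ∀ i, n ≤ i → lam i < lmax + ε) (hα_neg : lmax + ε < 0) :
    ∃ M : ℝ, 1 ≤ M ∧
      (∀ x₀ : StateSpace 𝕜, ∃ x : ℝ → StateSpace 𝕜,
        IsClosedLoopSolution ρ a q₀ q₁ K φ x ∧ x 0 = x₀) ∧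
      (∀ x : ℝ → StateSpace 𝕜, IsClosedLoopSolution ρ a q₀ q₁ K φ x →
        ∀ t : ℝ, 0 ≤ t → ‖x t‖ ≤ M * Real.exp ((lmax + ε) * t) * ‖x 0‖) := by
  set α := lmax + ε with hα
  rw [modalMatrix_sub_inputMatrix_mul] at hmax
  set κ := feedbackGain ρ φ K with hκ
  have hM : ∀ z ∈ spectrum ℂ ((modalMatrix n lam - Matrix.of fun i j : Fin n => κ i j).map
      (algebraMap ℝ ℂ)), z.re < α := fun z hz =>
    (hmax.2 ⟨z, hz, rfl⟩).trans_lt (by linarith)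
  obtain ⟨b, hb⟩ := hφ.exists_hilbertBasis 𝕜 hρ.ne' ha
  obtain ⟨C, hC0, hC⟩ := exists_modal_bound (𝕜 := 𝕜) hM hα_modes
  have hσ := summable_sq_spilloverWeight hρ.ne' ha hφ K hα_modes
  set σ := spilloverWeight lam κ α with hσdef
  -- The constant results from (a + b)² ≤ 2a² + 2b², Parseval's identity, and the bound of the n
  -- initial low modes by n ‖x(0)‖ in total.
  refine ⟨Real.sqrt (2 + 2 * (C * n) ^ 2 * ∑' i, σ i ^ 2), ?_, fun x₀ => ?_, fun x hx t ht => ?_⟩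
  · rw [Real.one_le_sqrt]
    have : 0 ≤ 2 * (C * n) ^ 2 * ∑' i, σ i ^ 2 :=
      mul_nonneg (by positivity) (tsum_nonneg fun i => sq_nonneg _)
    linarith
  · obtain ⟨c, e, hc, he, hc0, hcd, hce⟩ := exists_modal_solution lam κ fun i => b.repr x₀ i
    have hx₀ := (b.hasSum_norm_sq_repr x₀).summable
    have hcs : Summable fun i => ‖c i 0‖ ^ 2 := by simpa only [hc0] using hx₀
    have hm := hcs.add_sq (hσ.const_mul_sq (C * ∑ j : Fin n, ‖c j 0‖))
    have hcm : ∀ t : ℝ, 0 ≤ t → ∀ i,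
        ‖c i t‖ ≤ ‖c i 0‖ + C * (∑ j : Fin n, ‖c j 0‖) * σ i := by
      intro t ht i
      refine (norm_modal_le hα_modes ht (hC c hc t ht) i).trans ?_
      refine mul_le_of_le_one_left ?_
        (Real.exp_le_one_iff.2 (mul_nonpos_of_nonpos_of_nonneg hα_neg.le ht))
      have := spilloverWeight_nonneg (κ := κ) hα_modes i
      positivity
    -- The trajectory must be a function on all of ℝ, but only its values for t ≥ 0 are constrained.
    have hex : ∀ t : ℝ, ∃ v : StateSpace 𝕜, 0 ≤ t → ∀ i, b.repr v i = c i t := by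
      intro t
      by_cases ht : 0 ≤ t
      · obtain ⟨v, hv⟩ := b.exists_repr_eq hm (hcm t ht)
        exact ⟨v, fun _ => hv⟩
      · exact ⟨0, fun h => absurd h ht⟩
    choose x hx using hex
    refine ⟨x, ⟨fun t ht => ?_, fun t ht => ?_⟩, ?_⟩
    · refine b.tendsto_of_dominated hm ?_ fun i => ?_
      · filter_upwards [self_mem_nhdsWithin] with s hs i
        rw [hx s hs i]
        exact hcm s hs i
      · rw [hx t ht i]
        refine ((hc i).1 t ht).congr' ?_
        filter_upwards [self_mem_nhdsWithin] with s hs using (hx s hs i).symm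
    -- The ball of radius t/2 stays at times at least t/2, so smoothing with τ = t/2 dominates all
    -- derivatives on it at once.
    · have hpos : ∀ s ∈ Metric.ball t (t / 2), t / 2 ≤ s := by
        intro s hs
        rw [Metric.mem_ball, Real.dist_eq, abs_lt] at hs
        linarith [hs.1]
      have hm' := (hcs.const_mul_sq (1 / (t / 2) + |α|)).add_sq (hσ.const_mul_sq
        (1 / (t / 2) * (∑ j : Fin n, ‖c j 0‖) + C * (∑ j : Fin n, ‖e j 0‖)))
      have hem : ∀ s ∈ Metric.ball t (t / 2), ∀ i, ‖e i s‖ ≤ _ := fun s hs i =>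
        norm_modal_deriv_le hα_modes hα_neg hC0 (half_pos ht) (hpos s hs) hce
          (hC e he s ((half_pos ht).le.trans (hpos s hs))) i
      obtain ⟨y, hy⟩ := b.exists_repr_eq hm' (hem t (Metric.mem_ball_self (half_pos ht)))
      have hd : HasDerivAt x y t := b.hasDerivAt_of_dominated hm' (half_pos ht)
        (fun s hs => hx s ((half_pos ht).le.trans (hpos s hs))) (fun i s _ => hcd i s) hem hy
      obtain ⟨h, hxh, H⟩ := hφ.exists_robinRel_of_modal hρ.ne' ha (x := x t) (y := y)
        (u := feedback K φ (x t)) fun i => by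
          rw [input_feedback_eq, ← hb, hy, hce]
          simp only [← hb, hx t ht.le, sub_eq_add_neg]
          rfl
      exact ⟨h, y, hd, hxh, H⟩
    · refine b.repr.injective (lp.ext (funext fun i => ?_))
      rw [hx 0 le_rfl i, hc0]
  · have hmod := hx.isModalSolution ha hφ
    have hc0 : ∀ i, ‖eigenfunctional (φ i) (x 0)‖ ≤ ‖x 0‖ := fun i => by
      rw [← hb, ← b.repr.norm_map (x 0)]
      exact lp.norm_apply_le_norm (by norm_num) _ i
    set S := ∑ j : Fin n, ‖eigenfunctional (φ j) (x 0)‖ with hS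
    have hS0 : 0 ≤ S := Finset.sum_nonneg fun j _ => norm_nonneg _
    have hSn : S ≤ n * ‖x 0‖ := by
      have : ∑ _j : Fin n, ‖x 0‖ = n * ‖x 0‖ := by simp
      rw [← this]
      exact Finset.sum_le_sum fun j _ => hc0 j
    have hbd : ∀ i, ‖b.repr (x t) i‖ ^ 2 ≤
        Real.exp (α * t) ^ 2 * (2 * ‖b.repr (x 0) i‖ ^ 2 + 2 * (C * S) ^ 2 * σ i ^ 2) := by
      intro i
      have h1 := norm_modal_le (c := fun i t => eigenfunctional (φ i) (x t)) hα_modes ht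
        (hC _ hmod t ht) i
      simp only [← hb] at h1
      refine (pow_le_pow_left₀ (norm_nonneg _) h1 2).trans ?_
      rw [mul_pow]
      gcongr
      refine add_sq_le.trans (le_of_eq ?_)
      simp only [hS, ← hb, hσdef]
      ring
    have hx0 := b.hasSum_norm_sq_repr (x 0)
    have hsum := ((hx0.mul_left 2).add (hσ.hasSum.mul_left (2 * (C * S) ^ 2))).mul_left
      (Real.exp (α * t) ^ 2)
    have hle := hasSum_le hbd (b.hasSum_norm_sq_repr (x t)) hsum
    have hT : 0 ≤ ∑' i, σ i ^ 2 := tsum_nonneg fun i => sq_nonneg _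
    refine le_of_sq_le_sq (?_ : ‖x t‖ ^ 2 ≤ _) (by positivity)
    rw [mul_pow, mul_pow, Real.sq_sqrt (by positivity)]
    refine hle.trans ?_
    calc _ ≤ Real.exp (α * t) ^ 2 *
          (2 * ‖x 0‖ ^ 2 + 2 * (C * (n * ‖x 0‖)) ^ 2 * ∑' i, σ i ^ 2) := by gcongr
      _ = _ := by ring
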